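/- Conventions. A space is quasi-compact if every open cover has a finite subcover; compact means quasi-compact and Hausdorff. An ample groupoid is a topological groupoid $\mathcal G$, not necessarily Hausdorff, whose unit space $\mathcal G^0$ is locally compact, Hausdorff and totally disconnected and whose source map $\boldsymbol s\colon\mathcal G\to\mathcal G^0$ is a local homeomorphism; $\boldsymbol r$ denotes the range map. For a unital ring $R$ and a space $X$ with a basis of compact open sets, $RX$ is the left $R$-module of functions $X\to R$ spanned by the characteristic functions of compact open subsets of $X$. Then $R\mathcal G$ is a ring under convolution, $(f*h)(g)=\sum_{\boldsymbol r(a)=\boldsymbol r(g)}f(a)h(a^{-1}g)$, and $\mathbb Z\mathcal G^0$ is a right $\mathbb Z\mathcal G$-module via $(hf)(x)=\sum_{\boldsymbol s(g)=x}h(\boldsymbol r(g))f(g)$. A left $R\mathcal G$-module $M$ is unitary if $R\mathcal G\cdot M=M$, and dually for right modules. For a unitary left $R\mathcal G$-module $M$, which is also a left $\mathbb Z\mathcal G$-module via $\mathbb Z\mathcal G\to R\mathcal G$, put $H_n(\mathcal G,M)=\operatorname{Tor}_n^{\mathbb Z\mathcal G}(\mathbb Z\mathcal G^0,M)$, computed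 in the category of unitary modules. The $R$-homological dimension of $\mathcal G$ is the supremum of the integers $n$ such that $H_n(\mathcal G,M)\neq 0$ for some unitary left $R\mathcal G$-module $M$; it is $0$ if and only if $H_n(\mathcal G,M)=0$ for all $n\geq 1$ and all such $M$. Theorem. Let $R$ be a nonzero unital ring and let $\mathcal G$ be an ample groupoid of $R$-homological dimension $0$. Then: 1. $\mathcal G$ is a directed union of quasi-compact open subgroupoids; 2. the order of every finite subgroup of an isotropy group $\mathcal G_x^x$, $x\in\mathcal G^0$, is a unit in $R$. -/

import Mathlib

set_option linter.unusedSectionVars false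

open CategoryTheory Limits MulOpposite
open scoped TensorProduct

universe u v w

/-! ## Modules over rings without unit and their Tor groups -/

/-- The unital ring `ℤ ⊕ A` obtained from a (possibly non-unital) ring `A` by adjoining a unit. -/
def AdjoinUnit (A : Type u) [NonUnitalRing A] : Type u := Unitization ℤ A

namespace AdjoinUnit

variable {A : Type u} [NonUnitalRing A]

noncomputable instance instRing : Ring (AdjoinUnit A) := inferInstanceAs (Ring (Unitization ℤ A))

/-- The inclusion of `A` in `ℤ ⊕ A`. -/
def incl : A →ₙ+* AdjoinUnit A where
  toFun a := (Unitization.inr a : Unitization ℤ A)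
  map_mul' a b := Unitization.inr_mul ℤ a b
  map_zero' := Unitization.inr_zero ℤ
  map_add' a b := Unitization.inr_add ℤ a b

lemma exists_eq (x : AdjoinUnit A) : ∃ (n : ℤ) (a : A), x = (n : AdjoinUnit A) + incl a := by
  let y : Unitization ℤ A := x
  have h : ((y.fst : ℤ) : Unitization ℤ A) = Unitization.inl y.fst :=
    (map_intCast (Unitization.inlRingHom ℤ A) y.fst).symm
  refine ⟨y.fst, y.snd, ?_⟩
  exact (Unitization.inl_fst_add_inr_snd_eq y).symm.trans
    (congrArg (fun z : Unitization ℤ A => z + Unitization.inr y.snd) h.symm)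

lemma exists_incl_mul (a : A) (x : AdjoinUnit A) : ∃ b : A, incl a * x = incl b := by
  obtain ⟨n, c, rfl⟩ := exists_eq x
  exact ⟨n • a + a * c, by rw [mul_add, map_add, map_mul, map_zsmul, zsmul_eq_mul, Int.cast_comm]⟩

/-- The unital ring homomorphism `ℤ ⊕ A → C` that extends a homomorphism `A → C`. -/
noncomputable def lift {C : Type v} [Ring C] (φ : A →ₙ+* C) : AdjoinUnit A →+* C :=
  (Unitization.lift (R := ℤ) (A := A) (C := C)
    { φ with map_smul' := fun n a => map_zsmul φ n a } : Unitization ℤ A →ₐ[ℤ] C).toRingHom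

lemma lift_incl {C : Type v} [Ring C] (φ : A →ₙ+* C) (a : A) : lift φ (incl a) = φ a :=
  congrArg (fun ψ : A →ₙₐ[ℤ] C => ψ a) (Unitization.lift.symm_apply_apply
    ({ φ with map_smul' := fun n a => map_zsmul φ n a } : A →ₙₐ[ℤ] C))

/-- The homomorphism `ℤ ⊕ A → ℤ ⊕ B` induced by a homomorphism `A → B`. -/
noncomputable def map {B : Type v} [NonUnitalRing B] (φ : A →ₙ+* B) :
    AdjoinUnit A →+* AdjoinUnit B :=
  lift (incl.comp φ)

end AdjoinUnit

open AdjoinUnit (incl)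

/-- A (possibly non-unital) ring has local units if every finite subset is fixed, from both sides,
by an idempotent. -/
class HasLocalUnits (A : Type u) [NonUnitalRing A] : Prop where
  exists_idem : ∀ s : Finset A, ∃ e : A, e * e = e ∧ ∀ a ∈ s, e * a = a ∧ a * e = a

/-- A left module over a non-unital ring `A` is the same thing as a unital module over
the ring `ℤ ⊕ A` obtained by adjoining a unit.  It is unitary if `A · N = N`. -/
def IsUnitaryLeft (A : Type u) [NonUnitalRing A] (N : Type w) [AddCommGroup N]
    [Module (AdjoinUnit A) N] : Prop :=
  AddSubgroup.closure {y : N | ∃ (a : A) (z : N), y = incl a • z} = ⊤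

/-- A right `A`-module `X`, that is, a unital right module over `ℤ ⊕ A`, is unitary
if `X · A = X`. -/
def IsUnitaryRight (A : Type u) [NonUnitalRing A] (X : Type w) [AddCommGroup X]
    [Module (AdjoinUnit A)ᵐᵒᵖ X] : Prop :=
  AddSubgroup.closure {y : X | ∃ (a : A) (z : X), y = op (incl a) • z} = ⊤

lemma IsUnitaryRight.of_forall {A : Type u} [NonUnitalRing A] {X : Type w} [AddCommGroup X]
    [Module (AdjoinUnit A)ᵐᵒᵖ X] (h : ∀ x : X, ∃ a : A, op (incl a) • x = x) :
    IsUnitaryRight A X := by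
  refine (AddSubgroup.eq_top_iff' _).2 fun x => ?_
  obtain ⟨a, ha⟩ := h x
  exact AddSubgroup.subset_closure ⟨a, x, ha.symm⟩

lemma IsUnitaryRight.exists_idem {A : Type u} [NonUnitalRing A] [HasLocalUnits A] {X : Type w}
    [AddCommGroup X] [Module (AdjoinUnit A)ᵐᵒᵖ X] (h : IsUnitaryRight A X) (s : Finset X) :
    ∃ e : A, e * e = e ∧ ∀ x ∈ s, op (incl e) • x = x := by
  classical
  have key : ∀ x : X, ∃ t : Finset A, ∀ e : A, (∀ a ∈ t, a * e = a) →
      op (incl e) • x = x := by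
    intro x
    have hx : x ∈ AddSubgroup.closure {y : X | ∃ (a : A) (z : X), y = op (incl a) • z} := by
      rw [show AddSubgroup.closure _ = ⊤ from h]; trivial
    induction hx using AddSubgroup.closure_induction with
    | mem x hx =>
      obtain ⟨a, z, rfl⟩ := hx
      refine ⟨{a}, fun e he => ?_⟩
      rw [smul_smul, ← op_mul, ← map_mul, he a (by simp)]
    | zero => exact ⟨∅, by simp⟩
    | add x y _ _ hx hy =>
      obtain ⟨s, hs⟩ := hx
      obtain ⟨t, ht⟩ := hy
      refine ⟨s ∪ t, fun e he => ?_⟩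
      rw [smul_add, hs e fun a ha => he a (by simp [ha]), ht e fun a ha => he a (by simp [ha])]
    | neg x _ hx =>
      obtain ⟨s, hs⟩ := hx
      exact ⟨s, fun e he => by rw [smul_neg, hs e he]⟩
  choose t ht using key
  obtain ⟨e, he, h'⟩ := HasLocalUnits.exists_idem (s.biUnion t)
  exact ⟨e, he, fun x hx => ht x e fun a ha =>
    (h' a (Finset.mem_biUnion.2 ⟨x, hx, ha⟩)).2⟩

/-- The property of being a unitary right `A`-module. -/
def unitaryRight (A : Type u) [NonUnitalRing A] :
    ObjectProperty (ModuleCat.{u} (AdjoinUnit A)ᵐᵒᵖ) :=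
  fun X => IsUnitaryRight A X

/-- The category of unitary right `A`-modules. -/
abbrev UnitaryRightMod (A : Type u) [NonUnitalRing A] := (unitaryRight A).FullSubcategory

section Abelian

variable (A : Type u) [NonUnitalRing A] [HasLocalUnits A]

instance : (unitaryRight A).IsClosedUnderSubobjects where
  prop_of_mono {X Y} f _ hY := by
    refine IsUnitaryRight.of_forall fun x => ?_
    obtain ⟨e, -, he⟩ := IsUnitaryRight.exists_idem hY {f.hom x}
    refine ⟨e, (ModuleCat.mono_iff_injective f).1 inferInstance ?_⟩
    simpa using he (f.hom x) (by simp)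

instance : (unitaryRight A).IsClosedUnderQuotients where
  prop_of_epi {X Y} f _ hX := by
    refine IsUnitaryRight.of_forall fun y => ?_
    obtain ⟨x, rfl⟩ := (ModuleCat.epi_iff_surjective f).1 inferInstance y
    obtain ⟨e, -, he⟩ := IsUnitaryRight.exists_idem hX {x}
    refine ⟨e, ?_⟩
    have := congrArg f.hom (he x (by simp))
    simpa using this

instance : (unitaryRight A).IsClosedUnderFiniteProducts where
  isClosedUnderLimitsOfShape J _ := ⟨by
    rintro X ⟨h⟩
    classical
    have := Fintype.ofFinite J
    refine IsUnitaryRight.of_forall fun x => ?_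
    have h1 : ∀ j : J, ∃ t : Finset A, ∀ e : A, (∀ a ∈ t, a * e = a) →
        op (incl e) • (h.π.app ⟨j⟩).hom x = (h.π.app ⟨j⟩).hom x := by
      intro j
      obtain ⟨a, -, ha⟩ := IsUnitaryRight.exists_idem (h.prop_diag_obj ⟨j⟩) {(h.π.app ⟨j⟩).hom x}
      refine ⟨{a}, fun e he => ?_⟩
      have ha := ha _ (Finset.mem_singleton_self _)
      conv_lhs => rw [← ha]
      rw [smul_smul, ← op_mul, ← map_mul, he a (by simp), ha]
    choose t ht using h1
    obtain ⟨e, -, he⟩ := HasLocalUnits.exists_idem (Finset.univ.biUnion t)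
    refine ⟨e, Concrete.isLimit_ext _ h.isLimit _ _ ?_⟩
    rintro ⟨j⟩
    have := ht j e fun a ha => (he a (Finset.mem_biUnion.2 ⟨j, by simp, ha⟩)).2
    simpa using this⟩

instance : (unitaryRight A).ContainsZero where
  exists_zero := ⟨ModuleCat.of _ PUnit, ModuleCat.isZero_of_subsingleton _,
    IsUnitaryRight.of_forall fun _ => ⟨0, Subsingleton.elim _ _⟩⟩

noncomputable instance : Abelian (UnitaryRightMod A) := inferInstance

instance : EnoughProjectives (UnitaryRightMod A) where
  presentation X := by
    classical
    have h := fun x : X.obj => IsUnitaryRight.exists_idem X.property {x}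
    choose e he hx using h
    have hx : ∀ x, op (incl (e x)) • x = x := fun x => hx x x (by simp)
    have hE : ∀ x, incl (e x) * incl (e x) = incl (e x) := fun x => by rw [← map_mul, he]
    let B := (AdjoinUnit A)ᵐᵒᵖ
    -- `q` is the projection of a free module on the direct sum of the modules `e x * A`
    let q : (X.obj →₀ B) →ₗ[B] (X.obj →₀ B) :=
      Finsupp.linearCombination B fun x => Finsupp.single x (op (incl (e x)))
    have hq : ∀ x b, q (Finsupp.single x b) = Finsupp.single x (b * op (incl (e x))) := by
      intro x b
      simp [q]
    have hqq : ∀ f, q (q f) = q f := by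
      intro f
      induction f using Finsupp.induction_linear with
      | zero => simp
      | add f g hf hg => rw [map_add, map_add, hf, hg]
      | single x b => rw [hq, hq, mul_assoc, ← op_mul, hE]
    let F : ModuleCat.{u} B := ModuleCat.of B (LinearMap.range q)
    have hF : unitaryRight A F := by
      have h1 : ∀ f, q.rangeRestrict f ∈ AddSubgroup.closure
          {y : LinearMap.range q | ∃ (a : A) (z : LinearMap.range q), y = op (incl a) • z} := by
        intro f
        induction f using Finsupp.induction_linear with
        | zero => rw [map_zero]; exact zero_mem _
        | add f g hf hg => rw [map_add]; exact add_mem hf hg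
        | single x b =>
          obtain ⟨a, ha⟩ := AdjoinUnit.exists_incl_mul (e x) (unop b)
          refine AddSubgroup.subset_closure ⟨a, q.rangeRestrict (Finsupp.single x 1), ?_⟩
          apply Subtype.ext
          change q _ = op (incl a) • q _
          rw [hq, hq, Finsupp.smul_single, smul_eq_mul, one_mul, ← ha, op_mul, op_unop, mul_assoc,
            ← op_mul, hE]
      refine (AddSubgroup.eq_top_iff' _).2 ?_
      rintro ⟨_, f, rfl⟩
      exact h1 f
    have : Module.Projective B (LinearMap.range q) :=
      Module.Projective.of_split (LinearMap.range q).subtype q.rangeRestrict <| by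
        ext1 ⟨_, f, rfl⟩
        exact Subtype.ext (hqq f)
    have hP : Projective F := (IsProjective.iff_projective (LinearMap.range q)).1 this
    have hepi := (unitaryRight A).preservesEpimorphisms_ι_of_isNormalMonoCategory
    let p : F ⟶ X.obj := ModuleCat.ofHom
      ((Finsupp.linearCombination B (id : X.obj → X.obj)).comp (LinearMap.range q).subtype)
    have hp : Epi p := (ModuleCat.epi_iff_surjective p).2 fun x =>
      ⟨q.rangeRestrict (Finsupp.single x 1), by
        change Finsupp.linearCombination B id (q (Finsupp.single x 1)) = x
        rw [hq, one_mul, Finsupp.linearCombination_single]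
        exact hx x⟩
    refine ⟨{ p := ⟨F, hF⟩, projective := ⟨fun {Z Y} f g _ => ?_⟩, f := ObjectProperty.homMk p,
              epi := ?_ }⟩
    · have : Epi ((unitaryRight A).ι.map g) := inferInstance
      obtain ⟨k, hk⟩ := hP.factors f.hom ((unitaryRight A).ι.map g)
      exact ⟨ObjectProperty.homMk k, (unitaryRight A).ι.map_injective hk⟩
    · exact (unitaryRight A).ι.epi_of_epi_map hp

end Abelian

section Tor

variable (A : Type u) [NonUnitalRing A]

/-- The relations `x a ⊗ n = x ⊗ a n` that define the tensor product over `A`. -/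
def balancedRel (X : Type v) [AddCommGroup X] [Module (AdjoinUnit A)ᵐᵒᵖ X]
    (N : Type w) [AddCommGroup N] [Module (AdjoinUnit A) N] : AddSubgroup (X ⊗[ℤ] N) :=
  AddSubgroup.closure {t | ∃ (x : X) (a : A) (n : N),
    t = (op (incl a) • x) ⊗ₜ[ℤ] n - x ⊗ₜ[ℤ] (incl a • n)}

/-- The tensor product `X ⊗_A N` of a right `A`-module and a left `A`-module. -/
abbrev BalancedTensor (X : Type v) [AddCommGroup X] [Module (AdjoinUnit A)ᵐᵒᵖ X]
    (N : Type w) [AddCommGroup N] [Module (AdjoinUnit A) N] : Type max v w :=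
  (X ⊗[ℤ] N) ⧸ balancedRel A X N

/-- The homomorphism `f ⊗ id : X ⊗_A N → Y ⊗_A N`. -/
noncomputable def BalancedTensor.map {X Y : Type v} [AddCommGroup X] [AddCommGroup Y]
    [Module (AdjoinUnit A)ᵐᵒᵖ X] [Module (AdjoinUnit A)ᵐᵒᵖ Y] (N : Type w) [AddCommGroup N]
    [Module (AdjoinUnit A) N] (f : X →ₗ[(AdjoinUnit A)ᵐᵒᵖ] Y) :
    BalancedTensor A X N →+ BalancedTensor A Y N :=
  QuotientAddGroup.map (balancedRel A X N) (balancedRel A Y N)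
    (LinearMap.rTensor N f.toAddMonoidHom.toIntLinearMap).toAddMonoidHom (by
      refine (AddSubgroup.closure_le _).2 ?_
      rintro _ ⟨x, a, n, rfl⟩
      exact AddSubgroup.subset_closure ⟨f x, a, n, by simp⟩)

lemma BalancedTensor.hom_ext {X : Type v} [AddCommGroup X] [Module (AdjoinUnit A)ᵐᵒᵖ X]
    {N : Type w} [AddCommGroup N] [Module (AdjoinUnit A) N] {C : Type*} [AddCommGroup C]
    {f g : BalancedTensor A X N →+ C}
    (h : ∀ (x : X) (n : N), f (QuotientAddGroup.mk (x ⊗ₜ n)) = g (QuotientAddGroup.mk (x ⊗ₜ n))) :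
    f = g := by
  ext t
  change f (QuotientAddGroup.mk t) = g (QuotientAddGroup.mk t)
  induction t using TensorProduct.induction_on with
  | zero => simp
  | tmul x n => exact h x n
  | add x y hx hy => rw [QuotientAddGroup.mk_add, map_add, map_add, hx, hy]

/-- The functor `X ↦ X ⊗_A N` from unitary right `A`-modules to abelian groups. -/
noncomputable def tensorFunctor (N : Type w) [AddCommGroup N] [Module (AdjoinUnit A) N] :
    UnitaryRightMod A ⥤ AddCommGrpCat.{max u w} where
  obj X := AddCommGrpCat.of (BalancedTensor A X.obj N)
  map f := AddCommGrpCat.ofHom (BalancedTensor.map A N f.hom.hom)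
  map_id _ := AddCommGrpCat.hom_ext (BalancedTensor.hom_ext A fun _ _ => rfl)
  map_comp _ _ := AddCommGrpCat.hom_ext (BalancedTensor.hom_ext A fun _ _ => rfl)

instance (N : Type w) [AddCommGroup N] [Module (AdjoinUnit A) N] :
    (tensorFunctor A N).Additive where
  map_add {_ Y f g} := AddCommGrpCat.hom_ext (BalancedTensor.hom_ext A fun x n =>
    congrArg (QuotientAddGroup.mk (s := balancedRel A Y.obj N))
      (TensorProduct.add_tmul (f.hom.hom x) (g.hom.hom x) n))

/-- `Tor_n^A(X, N)`: the left derived functors of `X ↦ X ⊗_A N` on the abelian category of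
unitary right `A`-modules. -/
noncomputable def unitaryTor [HasLocalUnits A] (n : ℕ) (X : UnitaryRightMod A)
    (N : Type w) [AddCommGroup N] [Module (AdjoinUnit A) N] : AddCommGrpCat.{max u w} :=
  ((tensorFunctor A N).leftDerived n).obj X

end Tor

/-! ## Ample groupoids -/

/-- The set of all arrows of a (small) groupoid with set of objects `G`.  The source of an arrow `g`
is `g.left` and its range is `g.right`. -/
abbrev Arrows (G : Type u) [Groupoid.{u} G] : Type u := Quiver.Total G

namespace Arrows

variable {G : Type u} [Groupoid.{u} G]

/-- The unit at `x`. -/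
def unit (x : G) : Arrows G := ⟨x, x, 𝟙 x⟩

/-- The inverse of an arrow. -/
noncomputable def inverse (g : Arrows G) : Arrows G := ⟨g.right, g.left, inv g.hom⟩

/-- The product `gh`, defined if the source of `g` is the range of `h`. -/
def mul (g h : Arrows G) (e : h.right = g.left) : Arrows G :=
  ⟨h.left, g.right, h.hom ≫ eqToHom e ≫ g.hom⟩

lemma inverse_inverse (g : Arrows G) : g.inverse.inverse = g := by
  simp [inverse]

/-- The product of two sets of arrows. -/
def setMul (U V : Set (Arrows G)) : Set (Arrows G) :=
  {γ | ∃ a : Σ z : G, z ⟶ γ.right, (⟨a.1, γ.right, a.2⟩ : Arrows G) ∈ U ∧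
    (⟨γ.left, a.1, γ.hom ≫ inv a.2⟩ : Arrows G) ∈ V}

lemma mem_setMul_iff {U V : Set (Arrows G)} {γ : Arrows G} : γ ∈ setMul U V ↔
    ∃ g ∈ U, ∃ h ∈ V, ∃ e : h.right = g.left, mul g h e = γ := by
  constructor
  · rintro ⟨a, h1, h2⟩
    exact ⟨_, h1, _, h2, rfl, by simp [mul]⟩
  · rintro ⟨⟨x, y, g⟩, hg, ⟨z, w, h⟩, hh, e, rfl⟩
    obtain rfl : w = x := e
    refine ⟨⟨_, g⟩, hg, ?_⟩
    have h1 : (h ≫ 𝟙 w ≫ g) ≫ inv g = h := by simp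
    change (⟨z, w, (h ≫ 𝟙 w ≫ g) ≫ inv g⟩ : Arrows G) ∈ V
    rw [h1]
    exact hh

lemma setMul_assoc (U V W : Set (Arrows G)) :
    setMul (setMul U V) W = setMul U (setMul V W) := by
  ext γ
  constructor
  · rintro ⟨a, ⟨b, h1, h2⟩, h3⟩
    exact ⟨b, h1, ⟨a.1, a.2 ≫ inv b.2⟩, h2, by simpa using h3⟩
  · rintro ⟨b, h1, c, h2, h3⟩
    exact ⟨⟨c.1, c.2 ≫ b.2⟩, ⟨b, h1, by simpa using h2⟩, by simpa using h3⟩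

end Arrows

/-- A groupoid with a topology on its unit space and a topology on its space of arrows is an ample
groupoid if all structure maps are continuous, the unit space is locally compact, Hausdorff and
totally disconnected, and the source map is a local homeomorphism. The space of arrows need not be
Hausdorff. -/
class AmpleGroupoid (G : Type u) [Groupoid.{u} G] [TopologicalSpace G]
    [TopologicalSpace (Arrows G)] : Prop where
  continuous_source : Continuous fun g : Arrows G => g.left
  continuous_range : Continuous fun g : Arrows G => g.right
  continuous_unit : Continuous (Arrows.unit : G → Arrows G)
  continuous_inverse : Continuous (Arrows.inverse : Arrows G → Arrows G)
  continuous_mul : Continuous fun p : {p : Arrows G × Arrows G // p.2.right = p.1.left} =>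
    Arrows.mul p.1.1 p.1.2 p.2
  locallyCompactSpace : LocallyCompactSpace G
  t2Space : T2Space G
  totallyDisconnectedSpace : TotallyDisconnectedSpace G
  isLocalHomeomorph_source : IsLocalHomeomorph fun g : Arrows G => g.left

/-- The arrows that belong to a subgroupoid. -/
def CategoryTheory.Subgroupoid.arrowSet {G : Type u} [Groupoid.{u} G] (H : Subgroupoid G) :
    Set (Arrows G) :=
  {g | g.hom ∈ H.arrows g.left g.right}

/-- `G` is the union of a directed family of quasi-compact open subgroupoids. -/
def IsDirectedUnionOfQuasiCompactOpen (G : Type u) [Groupoid.{u} G]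
    [TopologicalSpace (Arrows G)] : Prop :=
  ∃ 𝓗 : Set (Subgroupoid G), 𝓗.Nonempty ∧ DirectedOn (· ≤ ·) 𝓗 ∧
    (∀ H ∈ 𝓗, IsOpen H.arrowSet ∧ IsCompact H.arrowSet) ∧ ⋃ H ∈ 𝓗, H.arrowSet = Set.univ

/-! ## Functions spanned by compact open sets -/

section Span

variable (R : Type v) [Ring R] (X : Type u) [TopologicalSpace X]

/-- `RX`: the left `R`-module of functions on `X` spanned by the characteristic functions of the
compact (in particular Hausdorff) open subsets of `X`. -/
def compactOpenSpan : Submodule R (X → R) :=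
  Submodule.span R {f | ∃ U : Set X, IsOpen U ∧ IsCompact U ∧ T2Space U ∧
    f = U.indicator fun _ => (1 : R)}

variable {R X}

lemma indicator_mem_compactOpenSpan {U : Set X} (h1 : IsOpen U) (h2 : IsCompact U)
    (h3 : T2Space U) (r : R) : (U.indicator fun _ => r) ∈ compactOpenSpan R X := by
  have : (U.indicator fun _ => r) = r • U.indicator fun _ => (1 : R) := by
    ext x
    by_cases hx : x ∈ U <;> simp [hx]
  rw [this]
  exact Submodule.smul_mem _ _ (Submodule.subset_span ⟨U, h1, h2, h3, rfl⟩)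

lemma compactOpenSpan_induction_aux {p : (X → R) → Prop} (zero : p 0)
    (add : ∀ f ∈ compactOpenSpan R X, ∀ g ∈ compactOpenSpan R X, p f → p g → p (f + g))
    (ind : ∀ (U : Set X), IsOpen U → IsCompact U → T2Space U → ∀ r : R, p (U.indicator fun _ => r))
    {f : X → R} (hf : f ∈ compactOpenSpan R X) : p f := by
  have key : ∀ r : R, p (r • f) := by
    induction hf using Submodule.span_induction with
    | mem f hf =>
      obtain ⟨U, h1, h2, h3, rfl⟩ := hf
      intro r
      have : r • (U.indicator fun _ => (1 : R)) = U.indicator fun _ => r := by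
        ext x
        by_cases hx : x ∈ U <;> simp [hx]
      rw [this]
      exact ind U h1 h2 h3 r
    | zero => simpa using zero
    | add f g hf hg h1 h2 =>
      intro r
      rw [smul_add]
      exact add _ (Submodule.smul_mem _ _ hf) _ (Submodule.smul_mem _ _ hg) (h1 r) (h2 r)
    | smul a f _ h =>
      intro r
      rw [smul_smul]
      exact h _
  simpa using key 1

@[elab_as_elim]
lemma compactOpenSpan_induction {p : (f : X → R) → f ∈ compactOpenSpan R X → Prop}
    (zero : p 0 (zero_mem _))
    (add : ∀ f hf g hg, p f hf → p g hg → p (f + g) (add_mem hf hg))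
    (ind : ∀ (U : Set X) (h1 : IsOpen U) (h2 : IsCompact U) (h3 : T2Space U) (r : R),
      p (U.indicator fun _ => r) (indicator_mem_compactOpenSpan h1 h2 h3 r))
    {f : X → R} (hf : f ∈ compactOpenSpan R X) : p f hf := by
  obtain ⟨_, h⟩ := compactOpenSpan_induction_aux (p := fun f => ∃ hf, p f hf) ⟨_, zero⟩
    (fun f hf g hg h1 h2 => ⟨_, add f hf g hg h1.2 h2.2⟩)
    (fun U h1 h2 h3 r => ⟨_, ind U h1 h2 h3 r⟩) hf
  exact h

end Span

namespace AmpleGroupoid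

variable {G : Type u} [Groupoid.{u} G] [TopologicalSpace G] [TopologicalSpace (Arrows G)]

/-- A compact bisection: a compact open set of arrows on which source and range are injective. -/
structure IsCompactBisection (U : Set (Arrows G)) : Prop where
  isOpen : IsOpen U
  isCompact : IsCompact U
  source_inj : Set.InjOn (fun g : Arrows G => g.left) U
  range_inj : Set.InjOn (fun g : Arrows G => g.right) U

attribute [local instance] locallyCompactSpace t2Space totallyDisconnectedSpace

variable [AmpleGroupoid G]

lemma IsCompactBisection.t2Space {U : Set (Arrows G)} (hU : IsCompactBisection U) : T2Space U :=
  T2Space.of_injective_continuous (f := fun g : U => g.1.left)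
    (fun g h e => Subtype.ext (hU.source_inj g.2 h.2 e))
    (continuous_source.comp continuous_subtype_val)

lemma exists_compactOpen_subset {O : Set G} (hO : IsOpen O) {x : G} (hx : x ∈ O) :
    ∃ K : Set G, IsOpen K ∧ IsCompact K ∧ x ∈ K ∧ K ⊆ O := by
  obtain ⟨C, hC, hxC, hCO⟩ := exists_compact_subset hO hx
  obtain ⟨V, hV, hxV, hVC⟩ := (loc_compact_Haus_tot_disc_of_zero_dim (H := G)).exists_subset_of_mem_open
    hxC isOpen_interior
  exact ⟨V, hV.2, hC.of_isClosed_subset hV.1 (hVC.trans interior_subset), hxV,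
    hVC.trans (interior_subset.trans hCO)⟩

/-- Inversion as a homeomorphism. -/
noncomputable def inverseHomeomorph : Arrows G ≃ₜ Arrows G where
  toFun := Arrows.inverse
  invFun := Arrows.inverse
  left_inv := Arrows.inverse_inverse
  right_inv := Arrows.inverse_inverse
  continuous_toFun := continuous_inverse
  continuous_invFun := continuous_inverse

lemma isLocalHomeomorph_range : IsLocalHomeomorph fun g : Arrows G => g.right :=
  isLocalHomeomorph_source.comp inverseHomeomorph.isLocalHomeomorph

lemma isOpenMap_unit : IsOpenMap (Arrows.unit : G → Arrows G) := by
  have : IsLocalHomeomorph (Arrows.unit : G → Arrows G) :=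
    IsLocalHomeomorph.of_comp (f := Arrows.unit) (g := fun g : Arrows G => g.left)
      (show IsLocalHomeomorph fun x : G => x from (Homeomorph.refl G).isLocalHomeomorph)
      isLocalHomeomorph_source
      continuous_unit
  exact this.isOpenMap

lemma exists_bisection_subset {O : Set (Arrows G)} (hO : IsOpen O) {g : Arrows G} (hg : g ∈ O) :
    ∃ U, IsCompactBisection U ∧ g ∈ U ∧ U ⊆ O := by
  obtain ⟨e, hge, he⟩ := (isLocalHomeomorph_source (G := G)) g
  obtain ⟨e', hge', he'⟩ := (isLocalHomeomorph_range (G := G)) g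
  set W : Set (Arrows G) := O ∩ e.source ∩ e'.source with hW
  have hWo : IsOpen W := (hO.inter e.open_source).inter e'.open_source
  have he1 : ∀ a : Arrows G, a.left = e a := fun a => congrFun he a
  have he1' : ∀ a : Arrows G, a.right = e' a := fun a => congrFun he' a
  obtain ⟨K, hKo, hKc, hgK, hK⟩ := exists_compactOpen_subset
    (isLocalHomeomorph_source.isOpenMap W hWo) (Set.mem_image_of_mem _ ⟨⟨hg, hge⟩, hge'⟩)
  have hU : W ∩ (fun a : Arrows G => a.left) ⁻¹' K = e.symm '' K := by
    ext a
    constructor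
    · rintro ⟨ha, haK⟩
      exact ⟨a.left, haK, by rw [he1, e.left_inv ha.1.2]⟩
    · rintro ⟨x, hx, rfl⟩
      obtain ⟨b, hb, rfl⟩ := hK hx
      simp only [he1] at hx ⊢
      rw [e.left_inv hb.1.2]
      exact ⟨hb, by simpa [he1] using hx⟩
  refine ⟨W ∩ (fun a : Arrows G => a.left) ⁻¹' K, ⟨hWo.inter (hKo.preimage continuous_source), ?_,
    ?_, ?_⟩, ⟨⟨⟨hg, hge⟩, hge'⟩, hgK⟩, fun a ha => ha.1.1.1⟩
  · rw [hU]
    refine hKc.image_of_continuousOn (e.continuousOn_symm.mono fun x hx => ?_)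
    obtain ⟨b, hb, rfl⟩ := hK hx
    simp only [he1]
    exact e.map_source hb.1.2
  · intro a ha b hb h
    exact e.injOn ha.1.1.2 hb.1.1.2 (by simpa [he1] using h)
  · intro a ha b hb h
    exact e'.injOn ha.1.2 hb.1.2 (by simpa [he1'] using h)

variable {R : Type v} [Ring R]

lemma IsCompactBisection.indicator_mem {U : Set (Arrows G)} (hU : IsCompactBisection U) (r : R) :
    (U.indicator fun _ => r) ∈ compactOpenSpan R (Arrows G) :=
  indicator_mem_compactOpenSpan hU.isOpen hU.isCompact hU.t2Space r

lemma bisection_induction_aux {p : (Arrows G → R) → Prop} (zero : p 0)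
    (add : ∀ f ∈ compactOpenSpan R (Arrows G), ∀ g ∈ compactOpenSpan R (Arrows G),
      p f → p g → p (f + g))
    (ind : ∀ U : Set (Arrows G), IsCompactBisection U → ∀ r : R, p (U.indicator fun _ => r))
    {f : Arrows G → R} (hf : f ∈ compactOpenSpan R (Arrows G)) : p f := by
  classical
  suffices h : ∀ U : Set (Arrows G), IsOpen U → IsCompact U → T2Space U → ∀ r : R,
      (U.indicator fun _ => r) ∈ compactOpenSpan R (Arrows G) ∧ p (U.indicator fun _ => r) from
    compactOpenSpan_induction_aux zero add (fun U h1 h2 h3 r => (h U h1 h2 h3 r).2) hf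
  intro U hUo hUc hU2 r
  refine ⟨indicator_mem_compactOpenSpan hUo hUc hU2 r, ?_⟩
  -- cover `U` by finitely many bisections
  have hcov : ∀ g : U, ∃ V, IsCompactBisection V ∧ g.1 ∈ V ∧ V ⊆ U := fun g =>
    exists_bisection_subset hUo g.2
  choose V hV hgV hVU using hcov
  obtain ⟨t, ht⟩ := hUc.elim_finite_subcover V (fun g => (hV g).isOpen)
    fun g hg => Set.mem_iUnion.2 ⟨⟨g, hg⟩, hgV _⟩
  have key : ∀ t : Finset U, ∀ W : Set (Arrows G), IsOpen W → IsCompact W → W ⊆ U →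
      W ⊆ ⋃ g ∈ t, V g → p (W.indicator fun _ => r) := by
    intro t
    induction t using Finset.induction_on with
    | empty =>
      intro W _ _ _ hW
      have : W = ∅ := by simpa using hW
      rw [this]
      rw [Set.indicator_empty]
      exact zero
    | insert a t _ ih =>
      intro W hWo hWc hWU hW
      obtain ⟨C, hC, hCV⟩ : ∃ C : Set (Arrows G), IsClosed C ∧ U ∩ C = V a := by
        have h1 : IsCompact ((Subtype.val : U → Arrows G) ⁻¹' V a) := by
          rw [Topology.IsInducing.subtypeVal.isCompact_iff, Subtype.image_preimage_coe,
            Set.inter_eq_right.2 (hVU a)]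
          exact (hV a).isCompact
        obtain ⟨C, hC, h2⟩ := isClosed_induced_iff.1 h1.isClosed
        refine ⟨C, hC, ?_⟩
        rw [← Subtype.image_preimage_coe, h2, Subtype.image_preimage_coe,
          Set.inter_eq_right.2 (hVU a)]
      have e1 : W ∩ C = W ∩ V a := by
        rw [← hCV, ← Set.inter_assoc, Set.inter_eq_left.2 hWU]
      have e2 : W \ C = W \ V a := by
        rw [← Set.sdiff_self_inter, e1, Set.sdiff_self_inter]
      have b1 : IsCompactBisection (W ∩ V a) :=
        ⟨hWo.inter (hV a).isOpen, e1 ▸ hWc.inter_right hC,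
          (hV a).source_inj.mono Set.inter_subset_right,
          (hV a).range_inj.mono Set.inter_subset_right⟩
      have o2 : IsOpen (W \ V a) := e2 ▸ hWo.sdiff hC
      have c2 : IsCompact (W \ V a) := hWc.diff (hV a).isOpen
      have t2 : T2Space ↑(W \ V a) :=
        T2Space.of_injective_continuous (f := Set.inclusion (Set.sdiff_subset.trans hWU))
          (Set.inclusion_injective _) (continuous_inclusion _)
      have hsum : (W.indicator fun _ => r) =
          ((W ∩ V a).indicator fun _ => r) + ((W \ V a).indicator fun _ => r) := by
        ext x
        by_cases h1 : x ∈ W <;> by_cases h2 : x ∈ V a <;> simp [h1, h2]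
      rw [hsum]
      refine add _ (b1.indicator_mem r) _ (indicator_mem_compactOpenSpan o2 c2 t2 r) (ind _ b1 r)
        (ih _ o2 c2 (Set.sdiff_subset.trans hWU) fun x hx => ?_)
      have := hW hx.1
      simp only [Finset.mem_insert, Set.iUnion_iUnion_eq_or_left, Set.mem_union] at this
      exact this.resolve_left hx.2
  exact key t U hUo hUc le_rfl ht

@[elab_as_elim]
lemma bisection_induction {p : (f : Arrows G → R) → f ∈ compactOpenSpan R (Arrows G) → Prop}
    (zero : p 0 (zero_mem _))
    (add : ∀ f hf g hg, p f hf → p g hg → p (f + g) (add_mem hf hg))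
    (ind : ∀ (U : Set (Arrows G)) (hU : IsCompactBisection U) (r : R),
      p (U.indicator fun _ => r) (hU.indicator_mem r))
    {f : Arrows G → R} (hf : f ∈ compactOpenSpan R (Arrows G)) : p f hf := by
  obtain ⟨_, h⟩ := bisection_induction_aux (p := fun f => ∃ hf, p f hf) ⟨_, zero⟩
    (fun f hf g hg h1 h2 => ⟨_, add f hf g hg h1.2 h2.2⟩)
    (fun U hU r => ⟨_, ind U hU r⟩) hf
  exact h

lemma IsCompactBisection.setMul {U V : Set (Arrows G)} (hU : IsCompactBisection U)
    (hV : IsCompactBisection V) : IsCompactBisection (Arrows.setMul U V) := by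
  refine ⟨?_, ?_, ?_, ?_⟩
  · rw [isOpen_iff_mem_nhds]
    intro γ hγ
    obtain ⟨g, hg, h, hh, e, rfl⟩ := Arrows.mem_setMul_iff.1 hγ
    obtain ⟨σ, hgσ, hσ⟩ := (isLocalHomeomorph_range (G := G)) g
    have hσ1 : ∀ a : Arrows G, a.right = σ a := fun a => congrFun hσ a
    let Ω : Set (Arrows G) := (fun a : Arrows G => a.right) ⁻¹' σ.target
    have hΩ : IsOpen Ω := σ.open_target.preimage continuous_range
    let s : Ω → Arrows G := fun a => σ.symm a.1.right
    have hs : Continuous s := σ.continuousOn_symm.comp_continuous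
      (continuous_range.comp continuous_subtype_val) fun a => a.2
    have hsr : ∀ a : Ω, (s a).right = a.1.right := fun a => by
      rw [hσ1]; exact σ.right_inv a.2
    let d : Ω → Arrows G := fun a => Arrows.mul (s a).inverse a.1 (hsr a).symm
    have hd : Continuous d := continuous_mul.comp
      (f := fun a : Ω => (⟨((s a).inverse, a.1), (hsr a).symm⟩ :
        {p : Arrows G × Arrows G // p.2.right = p.1.left}))
      (Continuous.subtype_mk ((continuous_inverse.comp hs).prodMk continuous_subtype_val) _)
    have hγΩ : Arrows.mul g h e ∈ Ω := by
      change g.right ∈ σ.target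
      rw [hσ1]
      exact σ.map_source hgσ
    have hsγ : s ⟨_, hγΩ⟩ = g := by
      change σ.symm g.right = g
      rw [hσ1, σ.left_inv hgσ]
    have hdγ : d ⟨_, hγΩ⟩ = h := by
      have : ∀ (k : Arrows G) (hk : k = g) (e' : (Arrows.mul g h e).right = k.inverse.left),
          Arrows.mul k.inverse (Arrows.mul g h e) e' = h := by
        intro k hk e'
        subst hk
        obtain ⟨x, y, k⟩ := k
        obtain ⟨z, w, h⟩ := h
        obtain rfl : w = x := e
        simp [Arrows.mul, Arrows.inverse]
      exact this _ hsγ _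
    have hopen : IsOpen (Subtype.val '' (s ⁻¹' U ∩ d ⁻¹' V)) :=
      hΩ.isOpenMap_subtype_val _ ((hU.isOpen.preimage hs).inter (hV.isOpen.preimage hd))
    refine Filter.mem_of_superset (hopen.mem_nhds ⟨⟨_, hγΩ⟩, ⟨?_, ?_⟩, rfl⟩) ?_
    · rw [Set.mem_preimage, hsγ]; exact hg
    · rw [Set.mem_preimage, hdγ]; exact hh
    · rintro _ ⟨a, ⟨h1, h2⟩, rfl⟩
      refine Arrows.mem_setMul_iff.2 ⟨s a, h1, d a, h2, rfl, ?_⟩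
      have : ∀ (k b : Arrows G) (e' : b.right = k.inverse.left),
          Arrows.mul k (Arrows.mul k.inverse b e') rfl = b := by
        rintro ⟨x, y, k⟩ ⟨z, w, b⟩ e'
        obtain rfl : w = y := e'
        simp [Arrows.mul, Arrows.inverse]
      exact this _ _ _
  · have hcl : IsClosed {p : Arrows G × Arrows G | p.2.right = p.1.left} :=
      isClosed_eq (continuous_range.comp continuous_snd) (continuous_source.comp continuous_fst)
    have hc := hcl.isClosedEmbedding_subtypeVal.isCompact_preimage
      (hU.isCompact.prod hV.isCompact)
    have := hc.image (continuous_mul (G := G))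
    convert this using 1
    ext γ
    rw [Arrows.mem_setMul_iff]
    constructor
    · rintro ⟨g, hg, h, hh, e, rfl⟩
      exact ⟨⟨(g, h), e⟩, ⟨hg, hh⟩, rfl⟩
    · rintro ⟨⟨⟨g, h⟩, e⟩, ⟨hg, hh⟩, rfl⟩
      exact ⟨g, hg, h, hh, e, rfl⟩
  · rintro _ h1 _ h2 he
    obtain ⟨g, hg, h, hh, e, rfl⟩ := Arrows.mem_setMul_iff.1 h1
    obtain ⟨g', hg', h', hh', e', rfl⟩ := Arrows.mem_setMul_iff.1 h2
    obtain rfl : h = h' := hV.source_inj hh hh' he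
    obtain rfl : g = g' := hU.source_inj hg hg' (e.symm.trans e')
    rfl
  · rintro _ h1 _ h2 he
    obtain ⟨g, hg, h, hh, e, rfl⟩ := Arrows.mem_setMul_iff.1 h1
    obtain ⟨g', hg', h', hh', e', rfl⟩ := Arrows.mem_setMul_iff.1 h2
    obtain rfl : g = g' := hU.range_inj hg hg' he
    obtain rfl : h = h' := hV.range_inj hh hh' (e.trans e'.symm)
    rfl

end AmpleGroupoid

/-! ## Convolution algebras -/

section Convolution

variable {G : Type u} [Groupoid.{u} G] {R : Type v} [Ring R]

/-- The convolution product: `(f * h)(γ)` is the sum of `f(a) h(a⁻¹ γ)` over all arrows `a` with the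
same range as `γ`. -/
noncomputable def convolution (f h : Arrows G → R) : Arrows G → R := fun γ =>
  ∑ᶠ a : Σ z : G, z ⟶ γ.right, f ⟨a.1, γ.right, a.2⟩ * h ⟨γ.left, a.1, γ.hom ≫ inv a.2⟩

/-- The action of functions of arrows on functions of units: `(h f)(x)` is the sum of
`h(r(g)) f(g)` over all arrows `g` with source `x`. -/
noncomputable def unitAction (h : G → R) (f : Arrows G → R) : G → R := fun x =>
  ∑ᶠ g : Σ y : G, x ⟶ y, h g.1 * f ⟨x, g.1, g.2⟩

/-- On every range fibre and on every source fibre the function is nonzero only finitely often. -/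
def FiberFinite (f : Arrows G → R) : Prop :=
  (∀ y : G, {a : Σ z : G, z ⟶ y | f ⟨a.1, y, a.2⟩ ≠ 0}.Finite) ∧
    ∀ x : G, {a : Σ y : G, x ⟶ y | f ⟨x, a.1, a.2⟩ ≠ 0}.Finite

lemma zero_convolution (h : Arrows G → R) : convolution 0 h = 0 := by
  ext γ; simp [convolution]

lemma convolution_zero (f : Arrows G → R) : convolution f 0 = 0 := by
  ext γ; simp [convolution]

lemma unitAction_zero (h : G → R) : unitAction h 0 = 0 := by
  ext γ; simp [unitAction]

lemma zero_unitAction (f : Arrows G → R) : unitAction 0 f = 0 := by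
  ext γ; simp [unitAction]

lemma add_convolution {f f' : Arrows G → R} (hf : FiberFinite f) (hf' : FiberFinite f')
    (h : Arrows G → R) : convolution (f + f') h = convolution f h + convolution f' h := by
  ext γ
  simp only [convolution, Pi.add_apply, add_mul]
  refine finsum_add_distrib ((hf.1 γ.right).subset fun a ha => ?_)
    ((hf'.1 γ.right).subset fun a ha => ?_)
  · exact left_ne_zero_of_mul ha
  · exact left_ne_zero_of_mul ha

lemma convolution_add {f : Arrows G → R} (hf : FiberFinite f) (h h' : Arrows G → R) :
    convolution f (h + h') = convolution f h + convolution f h' := by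
  ext γ
  simp only [convolution, Pi.add_apply, mul_add]
  refine finsum_add_distrib ((hf.1 γ.right).subset fun a ha => ?_)
    ((hf.1 γ.right).subset fun a ha => ?_)
  · exact left_ne_zero_of_mul ha
  · exact left_ne_zero_of_mul ha

lemma add_unitAction {f : Arrows G → R} (hf : FiberFinite f) (h h' : G → R) :
    unitAction (h + h') f = unitAction h f + unitAction h' f := by
  ext x
  simp only [unitAction, Pi.add_apply, add_mul]
  refine finsum_add_distrib ((hf.2 x).subset fun a ha => ?_) ((hf.2 x).subset fun a ha => ?_)
  · exact right_ne_zero_of_mul ha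
  · exact right_ne_zero_of_mul ha

lemma unitAction_add {f f' : Arrows G → R} (hf : FiberFinite f) (hf' : FiberFinite f')
    (h : G → R) : unitAction h (f + f') = unitAction h f + unitAction h f' := by
  ext x
  simp only [unitAction, Pi.add_apply, mul_add]
  refine finsum_add_distrib ((hf.2 x).subset fun a ha => ?_) ((hf'.2 x).subset fun a ha => ?_)
  · exact right_ne_zero_of_mul ha
  · exact right_ne_zero_of_mul ha

open Classical in
lemma convolution_unit_left (K : Set G) (f : Arrows G → R) (γ : Arrows G) :
    convolution ((Arrows.unit '' K).indicator fun _ => (1 : R)) f γ =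
      if γ.right ∈ K then f γ else 0 := by
  obtain ⟨x, y, γ⟩ := γ
  rw [convolution, finsum_eq_single _ ⟨y, 𝟙 y⟩]
  · have : (⟨y, y, 𝟙 y⟩ : Arrows G) ∈ Arrows.unit '' K ↔ y ∈ K :=
      ⟨fun ⟨z, hz, e⟩ => by cases e; exact hz, fun h => ⟨y, h, rfl⟩⟩
    by_cases h : y ∈ K <;> simp [Set.indicator, this, h]
  · rintro ⟨z, a⟩ hne
    have : (⟨z, y, a⟩ : Arrows G) ∉ Arrows.unit '' K := by
      rintro ⟨w, -, e⟩
      cases e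
      exact hne rfl
    simp [Set.indicator, this]

open Classical in
lemma convolution_unit_right (K : Set G) (f : Arrows G → R) (γ : Arrows G) :
    convolution f ((Arrows.unit '' K).indicator fun _ => (1 : R)) γ =
      if γ.left ∈ K then f γ else 0 := by
  obtain ⟨x, y, γ⟩ := γ
  rw [convolution, finsum_eq_single _ ⟨x, γ⟩]
  · have : (⟨x, x, γ ≫ inv γ⟩ : Arrows G) ∈ Arrows.unit '' K ↔ x ∈ K := by
      rw [IsIso.hom_inv_id]
      exact ⟨fun ⟨z, hz, e⟩ => by cases e; exact hz, fun h => ⟨x, h, rfl⟩⟩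
    by_cases h : x ∈ K <;> simp only [Set.indicator, this, h] <;> simp
  · rintro ⟨z, a⟩ hne
    have : (⟨x, z, γ ≫ inv a⟩ : Arrows G) ∉ Arrows.unit '' K := by
      rintro ⟨w, -, e⟩
      have e1 : w = x := congrArg (fun g : Arrows G => g.left) e
      have e2 : w = z := congrArg (fun g : Arrows G => g.right) e
      subst e1
      subst e2
      have e3 : 𝟙 w = γ ≫ inv a := by
        simpa [Arrows.unit] using e
      apply hne
      rw [IsIso.eq_comp_inv, Category.id_comp] at e3
      rw [e3]
    simp only [Set.indicator, this]
    simp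

open Classical in
lemma unitAction_unit (K : Set G) (h : G → R) (x : G) :
    unitAction h ((Arrows.unit '' K).indicator fun _ => (1 : R)) x = if x ∈ K then h x else 0 := by
  rw [unitAction, finsum_eq_single _ ⟨x, 𝟙 x⟩]
  · have : (⟨x, x, 𝟙 x⟩ : Arrows G) ∈ Arrows.unit '' K ↔ x ∈ K :=
      ⟨fun ⟨z, hz, e⟩ => by cases e; exact hz, fun h => ⟨x, h, rfl⟩⟩
    by_cases h : x ∈ K <;> simp [Set.indicator, this, h]
  · rintro ⟨z, a⟩ hne
    have : (⟨x, z, a⟩ : Arrows G) ∉ Arrows.unit '' K := by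
      rintro ⟨w, -, e⟩
      cases e
      exact hne rfl
    simp [Set.indicator, this]

end Convolution

namespace AmpleGroupoid

variable {G : Type u} [Groupoid.{u} G] [TopologicalSpace G] [TopologicalSpace (Arrows G)]
  {R : Type v} [Ring R]

attribute [local instance] locallyCompactSpace t2Space totallyDisconnectedSpace

lemma IsCompactBisection.fiberFinite {U : Set (Arrows G)} (hU : IsCompactBisection U) (r : R) :
    FiberFinite (U.indicator fun _ => r) := by
  refine ⟨fun y => Set.Subsingleton.finite ?_, fun x => Set.Subsingleton.finite ?_⟩
  · rintro ⟨z, a⟩ ha ⟨w, b⟩ hb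
    have := hU.range_inj (Set.mem_of_indicator_ne_zero ha) (Set.mem_of_indicator_ne_zero hb) rfl
    cases this
    rfl
  · rintro ⟨z, a⟩ ha ⟨w, b⟩ hb
    have := hU.source_inj (Set.mem_of_indicator_ne_zero ha) (Set.mem_of_indicator_ne_zero hb) rfl
    cases this
    rfl

lemma IsCompactBisection.convolution_indicator {U : Set (Arrows G)} (hU : IsCompactBisection U)
    (V : Set (Arrows G)) (r s : R) :
    convolution (U.indicator fun _ => r) (V.indicator fun _ => s) =
      (Arrows.setMul U V).indicator fun _ => r * s := by
  ext ⟨x, y, γ⟩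
  by_cases h : ∃ a : Σ z : G, z ⟶ y, (⟨a.1, y, a.2⟩ : Arrows G) ∈ U
  · obtain ⟨a, ha⟩ := h
    have huniq : ∀ b : Σ z : G, z ⟶ y, (⟨b.1, y, b.2⟩ : Arrows G) ∈ U → b = a := by
      rintro ⟨z, b⟩ hb
      have := hU.range_inj hb ha rfl
      cases this
      rfl
    have hm : (⟨x, y, γ⟩ : Arrows G) ∈ Arrows.setMul U V ↔
        (⟨x, a.1, γ ≫ inv a.2⟩ : Arrows G) ∈ V :=
      ⟨fun ⟨b, hb, hb'⟩ => by obtain rfl := huniq b hb; exact hb', fun h => ⟨a, ha, h⟩⟩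
    rw [convolution, finsum_eq_single _ a]
    · rw [Set.indicator_of_mem ha]
      by_cases hV : (⟨x, a.1, γ ≫ inv a.2⟩ : Arrows G) ∈ V
      · rw [Set.indicator_of_mem hV, Set.indicator_of_mem (hm.2 hV)]
      · rw [Set.indicator_of_notMem hV, Set.indicator_of_notMem (mt hm.1 hV), mul_zero]
    · intro b hb
      rw [Set.indicator_of_notMem fun h => hb (huniq b h), zero_mul]
  · have hm : (⟨x, y, γ⟩ : Arrows G) ∉ Arrows.setMul U V := fun ⟨a, ha, _⟩ => h ⟨a, ha⟩
    rw [Set.indicator_of_notMem hm, convolution]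
    refine finsum_eq_zero_of_forall_eq_zero fun a => ?_
    rw [Set.indicator_of_notMem fun ha => h ⟨a, ha⟩, zero_mul]

/-- The set of sources of the arrows in `V` whose range is in `K`. -/
def setAct (K : Set G) (V : Set (Arrows G)) : Set G :=
  (fun g : Arrows G => g.left) '' (V ∩ (fun g : Arrows G => g.right) ⁻¹' K)

lemma setAct_setMul (K : Set G) (U V : Set (Arrows G)) :
    setAct (setAct K U) V = setAct K (Arrows.setMul U V) := by
  ext x
  constructor
  · rintro ⟨h, ⟨hh, ⟨g, ⟨hg, hgK⟩, e⟩⟩, rfl⟩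
    exact ⟨Arrows.mul g h e.symm, ⟨Arrows.mem_setMul_iff.2 ⟨g, hg, h, hh, e.symm, rfl⟩, hgK⟩, rfl⟩
  · rintro ⟨_, ⟨hγ, hγK⟩, rfl⟩
    obtain ⟨g, hg, h, hh, e, rfl⟩ := Arrows.mem_setMul_iff.1 hγ
    exact ⟨h, ⟨hh, ⟨g, ⟨hg, hγK⟩, e.symm⟩⟩, rfl⟩

lemma IsCompactBisection.unitAction_indicator {V : Set (Arrows G)} (hV : IsCompactBisection V)
    (K : Set G) (r s : R) :
    unitAction (K.indicator fun _ => r) (V.indicator fun _ => s) =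
      (setAct K V).indicator fun _ => r * s := by
  ext x
  by_cases h : ∃ a : Σ y : G, x ⟶ y, (⟨x, a.1, a.2⟩ : Arrows G) ∈ V
  · obtain ⟨a, ha⟩ := h
    have huniq : ∀ b : Σ y : G, x ⟶ y, (⟨x, b.1, b.2⟩ : Arrows G) ∈ V → b = a := by
      rintro ⟨z, b⟩ hb
      have := hV.source_inj hb ha rfl
      cases this
      rfl
    have hm : x ∈ setAct K V ↔ a.1 ∈ K := by
      constructor
      · rintro ⟨⟨x, y, b⟩, ⟨hb, hbK⟩, rfl⟩
        have := huniq ⟨y, b⟩ hb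
        subst this
        exact hbK
      · exact fun h => ⟨_, ⟨ha, h⟩, rfl⟩
    rw [unitAction, finsum_eq_single _ a]
    · rw [Set.indicator_of_mem ha]
      by_cases hK : a.1 ∈ K
      · rw [Set.indicator_of_mem hK, Set.indicator_of_mem (hm.2 hK)]
      · rw [Set.indicator_of_notMem hK, Set.indicator_of_notMem (mt hm.1 hK), zero_mul]
    · intro b hb
      rw [Set.indicator_of_notMem fun h => hb (huniq b h), mul_zero]
  · rw [Set.indicator_of_notMem, unitAction]
    · refine finsum_eq_zero_of_forall_eq_zero fun a => ?_
      rw [Set.indicator_of_notMem fun ha => h ⟨a, ha⟩, mul_zero]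
    · rintro ⟨⟨x, y, b⟩, ⟨hb, -⟩, rfl⟩
      exact h ⟨⟨y, b⟩, hb⟩

variable [AmpleGroupoid G]

lemma isCompactBisection_unit {K : Set G} (hK : IsOpen K) (hK' : IsCompact K) :
    IsCompactBisection (Arrows.unit '' K) := by
  refine ⟨isOpenMap_unit K hK, hK'.image continuous_unit, ?_, ?_⟩
  · rintro _ ⟨x, -, rfl⟩ _ ⟨y, -, rfl⟩ (rfl : x = y)
    rfl
  · rintro _ ⟨x, -, rfl⟩ _ ⟨y, -, rfl⟩ (rfl : x = y)
    rfl

lemma isOpen_setAct {K : Set G} (hK : IsOpen K) {V : Set (Arrows G)} (hV : IsCompactBisection V) :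
    IsOpen (setAct K V) :=
  isLocalHomeomorph_source.isOpenMap _ (hV.isOpen.inter (hK.preimage continuous_range))

lemma isCompact_setAct {K : Set G} (hK : IsCompact K) {V : Set (Arrows G)}
    (hV : IsCompactBisection V) : IsCompact (setAct K V) :=
  (hV.isCompact.inter_right (hK.isClosed.preimage continuous_range)).image continuous_source

lemma fiberFinite {f : Arrows G → R} (hf : f ∈ compactOpenSpan R (Arrows G)) : FiberFinite f := by
  induction hf using bisection_induction with
  | zero => exact ⟨fun y => by simp, fun x => by simp⟩
  | add f _ g _ hf hg =>
    refine ⟨fun y => ((hf.1 y).union (hg.1 y)).subset fun a ha => ?_,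
      fun x => ((hf.2 x).union (hg.2 x)).subset fun a ha => ?_⟩ <;>
    · by_contra h
      simp only [Set.mem_union, Set.mem_ofPred_eq, not_or, not_not] at h
      exact ha (by rw [Pi.add_apply, h.1, h.2, add_zero])
  | ind U hU r => exact hU.fiberFinite r

lemma convolution_mem {f h : Arrows G → R} (hf : f ∈ compactOpenSpan R (Arrows G))
    (hh : h ∈ compactOpenSpan R (Arrows G)) : convolution f h ∈ compactOpenSpan R (Arrows G) := by
  induction hf using bisection_induction with
  | zero => rw [zero_convolution]; exact zero_mem _
  | add f hf g hg h1 h2 =>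
    rw [add_convolution (fiberFinite hf) (fiberFinite hg)]
    exact add_mem h1 h2
  | ind U hU r =>
    induction hh using bisection_induction with
    | zero => rw [convolution_zero]; exact zero_mem _
    | add f _ g _ h1 h2 =>
      rw [convolution_add (hU.fiberFinite r)]
      exact add_mem h1 h2
    | ind V hV s =>
      rw [hU.convolution_indicator]
      exact (hU.setMul hV).indicator_mem _

lemma convolution_assoc {f g h : Arrows G → R} (hf : f ∈ compactOpenSpan R (Arrows G))
    (hg : g ∈ compactOpenSpan R (Arrows G)) (hh : h ∈ compactOpenSpan R (Arrows G)) :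
    convolution (convolution f g) h = convolution f (convolution g h) := by
  induction hf using bisection_induction with
  | zero => simp only [zero_convolution]
  | add f hf f' hf' h1 h2 =>
    rw [add_convolution (fiberFinite hf) (fiberFinite hf'),
      add_convolution (fiberFinite hf) (fiberFinite hf'),
      add_convolution (fiberFinite (convolution_mem hf hg))
        (fiberFinite (convolution_mem hf' hg)), h1, h2]
  | ind U hU r =>
    induction hg using bisection_induction with
    | zero => simp only [zero_convolution, convolution_zero]
    | add g hg g' hg' h1 h2 =>
      rw [convolution_add (hU.fiberFinite r), add_convolution (fiberFinite hg) (fiberFinite hg'),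
        convolution_add (hU.fiberFinite r),
        add_convolution (fiberFinite (convolution_mem (hU.indicator_mem r) hg))
          (fiberFinite (convolution_mem (hU.indicator_mem r) hg')), h1, h2]
    | ind V hV s =>
      induction hh using bisection_induction with
      | zero => simp only [convolution_zero]
      | add h _ h' _ h1 h2 =>
        rw [convolution_add (fiberFinite (convolution_mem (hU.indicator_mem r) (hV.indicator_mem s))),
          convolution_add (hV.fiberFinite s), convolution_add (hU.fiberFinite r), h1, h2]
      | ind W hW t =>
        rw [hU.convolution_indicator, (hU.setMul hV).convolution_indicator,
          hV.convolution_indicator, hU.convolution_indicator, Arrows.setMul_assoc, mul_assoc]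

lemma unitAction_mem {h : G → R} {f : Arrows G → R} (hh : h ∈ compactOpenSpan R G)
    (hf : f ∈ compactOpenSpan R (Arrows G)) : unitAction h f ∈ compactOpenSpan R G := by
  induction hf using bisection_induction with
  | zero => rw [unitAction_zero]; exact zero_mem _
  | add f hf g hg h1 h2 =>
    rw [unitAction_add (fiberFinite hf) (fiberFinite hg)]
    exact add_mem h1 h2
  | ind V hV r =>
    induction hh using compactOpenSpan_induction with
    | zero => rw [zero_unitAction]; exact zero_mem _
    | add f _ g _ h1 h2 =>
      rw [add_unitAction (hV.fiberFinite r)]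
      exact add_mem h1 h2
    | ind K hK hK' _ s =>
      rw [hV.unitAction_indicator]
      exact indicator_mem_compactOpenSpan (isOpen_setAct hK hV) (isCompact_setAct hK' hV)
        inferInstance _

lemma unitAction_convolution {h : G → R} {f g : Arrows G → R} (hh : h ∈ compactOpenSpan R G)
    (hf : f ∈ compactOpenSpan R (Arrows G)) (hg : g ∈ compactOpenSpan R (Arrows G)) :
    unitAction (unitAction h f) g = unitAction h (convolution f g) := by
  induction hf using bisection_induction with
  | zero => simp only [unitAction_zero, zero_unitAction, zero_convolution]
  | add f hf f' hf' h1 h2 =>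
    rw [unitAction_add (fiberFinite hf) (fiberFinite hf'), add_unitAction (fiberFinite hg),
      add_convolution (fiberFinite hf) (fiberFinite hf'),
      unitAction_add (fiberFinite (convolution_mem hf hg))
        (fiberFinite (convolution_mem hf' hg)), h1, h2]
  | ind U hU r =>
    induction hg using bisection_induction with
    | zero => simp only [unitAction_zero, convolution_zero]
    | add g hg g' hg' h1 h2 =>
      rw [unitAction_add (fiberFinite hg) (fiberFinite hg'), convolution_add (hU.fiberFinite r),
        unitAction_add (fiberFinite (convolution_mem (hU.indicator_mem r) hg))
          (fiberFinite (convolution_mem (hU.indicator_mem r) hg')), h1, h2]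
    | ind V hV s =>
      induction hh using compactOpenSpan_induction with
      | zero => simp only [zero_unitAction]
      | add h _ h' _ h1 h2 =>
        rw [add_unitAction (hU.fiberFinite r), add_unitAction (hV.fiberFinite s),
          add_unitAction (fiberFinite (convolution_mem (hU.indicator_mem r) (hV.indicator_mem s))),
          h1, h2]
      | ind K _ _ _ t =>
        rw [hU.unitAction_indicator, hV.unitAction_indicator, hU.convolution_indicator,
          (hU.setMul hV).unitAction_indicator, setAct_setMul, mul_assoc]

lemma exists_unit_support {f : Arrows G → R} (hf : f ∈ compactOpenSpan R (Arrows G)) :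
    ∃ K : Set G, IsOpen K ∧ IsCompact K ∧ ∀ γ, f γ ≠ 0 → γ.left ∈ K ∧ γ.right ∈ K := by
  induction hf using bisection_induction with
  | zero => exact ⟨∅, isOpen_empty, isCompact_empty, fun γ h => absurd rfl h⟩
  | add f _ g _ hf hg =>
    obtain ⟨K, h1, h2, h3⟩ := hf
    obtain ⟨L, h1', h2', h3'⟩ := hg
    refine ⟨K ∪ L, h1.union h1', h2.union h2', fun γ hγ => ?_⟩
    by_cases h : f γ = 0
    · have : g γ ≠ 0 := fun h' => hγ (by rw [Pi.add_apply, h, h', add_zero])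
      exact ⟨Or.inr (h3' γ this).1, Or.inr (h3' γ this).2⟩
    · exact ⟨Or.inl (h3 γ h).1, Or.inl (h3 γ h).2⟩
  | ind U hU r =>
    refine ⟨(fun g : Arrows G => g.left) '' U ∪ (fun g : Arrows G => g.right) '' U,
      (isLocalHomeomorph_source.isOpenMap U hU.isOpen).union
        (isLocalHomeomorph_range.isOpenMap U hU.isOpen),
      (hU.isCompact.image continuous_source).union (hU.isCompact.image continuous_range),
      fun γ hγ => ?_⟩
    have := Set.mem_of_indicator_ne_zero hγ
    exact ⟨Or.inl ⟨γ, this, rfl⟩, Or.inr ⟨γ, this, rfl⟩⟩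

lemma exists_support {h : G → R} (hh : h ∈ compactOpenSpan R G) :
    ∃ K : Set G, IsOpen K ∧ IsCompact K ∧ ∀ x, h x ≠ 0 → x ∈ K := by
  induction hh using compactOpenSpan_induction with
  | zero => exact ⟨∅, isOpen_empty, isCompact_empty, fun γ h => absurd rfl h⟩
  | add f _ g _ hf hg =>
    obtain ⟨K, h1, h2, h3⟩ := hf
    obtain ⟨L, h1', h2', h3'⟩ := hg
    refine ⟨K ∪ L, h1.union h1', h2.union h2', fun γ hγ => ?_⟩
    by_cases h : f γ = 0
    · exact Or.inr (h3' γ fun h' => hγ (by rw [Pi.add_apply, h, h', add_zero]))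
    · exact Or.inl (h3 γ h)
  | ind K hK hK' _ r => exact ⟨K, hK, hK', fun x hx => Set.mem_of_indicator_ne_zero hx⟩

lemma intCast_comp_mem {X : Type*} [TopologicalSpace X] {f : X → ℤ}
    (hf : f ∈ compactOpenSpan ℤ X) : (fun x => (f x : R)) ∈ compactOpenSpan R X := by
  induction hf using compactOpenSpan_induction with
  | zero =>
    have : (fun x : X => (((0 : X → ℤ) x : ℤ) : R)) = 0 := by ext; simp
    rw [this]
    exact zero_mem _
  | add f _ g _ hf hg =>
    have : (fun x : X => (((f + g) x : ℤ) : R)) = (fun x => (f x : R)) + fun x => (g x : R) := by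
      ext; simp
    rw [this]
    exact add_mem hf hg
  | ind U h1 h2 h3 r =>
    have : (fun x : X => ((U.indicator (fun _ => r) x : ℤ) : R)) =
        U.indicator fun _ => (r : R) := by
      ext x
      by_cases hx : x ∈ U <;> simp [hx]
    rw [this]
    exact indicator_mem_compactOpenSpan h1 h2 h3 _

lemma intCast_convolution {f g : Arrows G → ℤ} (hf : f ∈ compactOpenSpan ℤ (Arrows G)) :
    (fun γ => ((convolution f g γ : ℤ) : R)) = convolution (fun γ => (f γ : R)) fun γ => (g γ : R) := by
  ext γ
  simp only [convolution]
  have hfin : (Function.support fun a : Σ z : G, z ⟶ γ.right =>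
      f ⟨a.1, γ.right, a.2⟩ * g ⟨γ.left, a.1, γ.hom ≫ inv a.2⟩).Finite :=
    ((fiberFinite hf).1 γ.right).subset fun a ha => left_ne_zero_of_mul ha
  simpa using AddMonoidHom.map_finsum (Int.castAddHom R) hfin

end AmpleGroupoid

section Algebra

variable (R : Type v) [Ring R] (G : Type u) [Groupoid.{u} G] [TopologicalSpace G]
  [TopologicalSpace (Arrows G)]

/-- The groupoid algebra `RG`: the functions on the space of arrows spanned by characteristic
functions of compact open sets, with pointwise addition and with convolution as product. -/
def GroupoidAlgebra : Type (max u v) := compactOpenSpan R (Arrows G)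

namespace GroupoidAlgebra

noncomputable instance : AddCommGroup (GroupoidAlgebra R G) :=
  inferInstanceAs (AddCommGroup (compactOpenSpan R (Arrows G)))

variable {R G}

@[ext]
lemma ext {a b : GroupoidAlgebra R G} (h : a.1 = b.1) : a = b := Subtype.ext h

variable [AmpleGroupoid G]

noncomputable instance : Mul (GroupoidAlgebra R G) :=
  ⟨fun a b => ⟨convolution a.1 b.1, AmpleGroupoid.convolution_mem a.2 b.2⟩⟩

noncomputable instance : NonUnitalRing (GroupoidAlgebra R G) where
  left_distrib a b c := ext (convolution_add (AmpleGroupoid.fiberFinite a.2) b.1 c.1)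
  right_distrib a b c := ext (add_convolution (AmpleGroupoid.fiberFinite a.2)
    (AmpleGroupoid.fiberFinite b.2) c.1)
  zero_mul a := ext (zero_convolution a.1)
  mul_zero a := ext (convolution_zero a.1)
  mul_assoc a b c := ext (AmpleGroupoid.convolution_assoc a.2 b.2 c.2)

/-- The characteristic function of a compact open set of units, as an element of `RG`. -/
noncomputable def unitIndicator (K : Set G) (hK : IsOpen K) (hK' : IsCompact K) :
    GroupoidAlgebra R G :=
  ⟨(Arrows.unit '' K).indicator fun _ => 1,
    (AmpleGroupoid.isCompactBisection_unit hK hK').indicator_mem 1⟩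

instance : HasLocalUnits (GroupoidAlgebra R G) where
  exists_idem s := by
    classical
    choose K hK hK' hf using fun a : GroupoidAlgebra R G => AmpleGroupoid.exists_unit_support a.2
    have hL : IsOpen (⋃ a ∈ s, K a) := isOpen_biUnion fun a _ => hK a
    have hL' : IsCompact (⋃ a ∈ s, K a) := s.isCompact_biUnion fun a _ => hK' a
    refine ⟨unitIndicator _ hL hL', ?_, fun a ha => ⟨?_, ?_⟩⟩
    · apply ext
      funext γ
      refine (convolution_unit_left _ _ γ).trans ?_
      split_ifs with h
      · rfl
      · have hm : γ ∉ Arrows.unit '' (⋃ a ∈ s, K a) := by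
          rintro ⟨x, hx, rfl⟩
          exact h hx
        exact (Set.indicator_of_notMem hm fun _ => (1 : R)).symm
    · apply ext
      funext γ
      refine (convolution_unit_left _ _ γ).trans ?_
      split_ifs with h
      · rfl
      · by_contra h0
        exact h (Set.mem_biUnion ha (hf a γ (Ne.symm h0)).2)
    · apply ext
      funext γ
      refine (convolution_unit_right _ _ γ).trans ?_
      split_ifs with h
      · rfl
      · by_contra h0
        exact h (Set.mem_biUnion ha (hf a γ (Ne.symm h0)).1)

/-- The ring homomorphism from `ℤG` to `RG` induced by the homomorphism from `ℤ` to `R`. -/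
noncomputable def ofInt (R : Type v) [Ring R] : GroupoidAlgebra ℤ G →ₙ+* GroupoidAlgebra R G where
  toFun a := ⟨fun γ => (a.1 γ : R), AmpleGroupoid.intCast_comp_mem a.2⟩
  map_mul' a _ := ext (AmpleGroupoid.intCast_convolution a.2)
  map_zero' := ext (funext fun _ => Int.cast_zero)
  map_add' a b := ext (funext fun γ => Int.cast_add (a.1 γ) (b.1 γ))

end GroupoidAlgebra

/-- The abelian group `ℤG⁰` of functions on the unit space spanned by the characteristic functions
of the compact open sets. -/
def UnitFunctions (G : Type u) [TopologicalSpace G] : Type u := compactOpenSpan ℤ G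

namespace UnitFunctions

noncomputable instance : AddCommGroup (UnitFunctions G) :=
  inferInstanceAs (AddCommGroup (compactOpenSpan ℤ G))

variable [AmpleGroupoid G]

/-- The right action of `ℤG` on `ℤG⁰`, as a homomorphism of rings. -/
noncomputable def actionHom : GroupoidAlgebra ℤ G →ₙ+* (AddMonoid.End (UnitFunctions G))ᵐᵒᵖ where
  toFun a := op
    { toFun := fun h => ⟨unitAction h.1 a.1, AmpleGroupoid.unitAction_mem h.2 a.2⟩
      map_zero' := Subtype.ext (zero_unitAction a.1)
      map_add' := fun h k =>
        Subtype.ext (add_unitAction (AmpleGroupoid.fiberFinite a.2) h.1 k.1) }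
  map_mul' a b := unop_injective <| AddMonoidHom.ext fun h =>
    Subtype.ext (AmpleGroupoid.unitAction_convolution h.2 a.2 b.2).symm
  map_zero' := unop_injective <| AddMonoidHom.ext fun h => Subtype.ext (unitAction_zero h.1)
  map_add' a b := unop_injective <| AddMonoidHom.ext fun h =>
    Subtype.ext (unitAction_add (AmpleGroupoid.fiberFinite a.2) (AmpleGroupoid.fiberFinite b.2) h.1)

noncomputable instance : Module (AdjoinUnit (GroupoidAlgebra ℤ G))ᵐᵒᵖ (UnitFunctions G) :=
  Module.compHom (UnitFunctions G)
    ((RingEquiv.opOp (AddMonoid.End (UnitFunctions G))).symm.toRingHom.comp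
      (RingHom.op (AdjoinUnit.lift (actionHom G))))

lemma smul_val (a : GroupoidAlgebra ℤ G) (h : UnitFunctions G) :
    (op (incl a) • h).1 = unitAction h.1 a.1 := by
  change ((unop (AdjoinUnit.lift (actionHom G) (incl a))) h).1 = _
  rw [AdjoinUnit.lift_incl]
  rfl

lemma isUnitaryRight : IsUnitaryRight (GroupoidAlgebra ℤ G) (UnitFunctions G) := by
  classical
  refine IsUnitaryRight.of_forall fun h => ?_
  obtain ⟨K, hK, hK', hh⟩ := AmpleGroupoid.exists_support h.2
  refine ⟨GroupoidAlgebra.unitIndicator K hK hK', Subtype.ext ?_⟩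
  rw [smul_val]
  funext x
  refine (unitAction_unit K h.1 x).trans ?_
  split_ifs with hx
  · rfl
  · by_contra h0
    exact hx (hh x (Ne.symm h0))

end UnitFunctions

variable [AmpleGroupoid G]

/-- The trivial right module `ℤG⁰`, as an object of the category of unitary right `ℤG`-modules. -/
noncomputable def trivialModule : UnitaryRightMod (GroupoidAlgebra ℤ G) :=
  ⟨ModuleCat.of _ (UnitFunctions G), UnitFunctions.isUnitaryRight G⟩

/-- The homology of `G` with coefficients in a left `ℤG`-module `N`:
`H_n(G, N) = Tor_n^{ℤG}(ℤG⁰, N)`. -/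
noncomputable def groupoidHomology (n : ℕ) (N : Type w) [AddCommGroup N]
    [Module (AdjoinUnit (GroupoidAlgebra ℤ G)) N] : AddCommGrpCat.{max u w} :=
  unitaryTor (GroupoidAlgebra ℤ G) n (trivialModule G) N

/-- The left `ℤG`-module underlying a left `RG`-module. -/
noncomputable def underlyingIntModule
    (N : ModuleCat.{w} (AdjoinUnit (GroupoidAlgebra R G))) :
    ModuleCat.{w} (AdjoinUnit (GroupoidAlgebra ℤ G)) :=
  (ModuleCat.restrictScalars (AdjoinUnit.map (GroupoidAlgebra.ofInt R))).obj N

/-- The `R`-homological dimension of `G`: the supremum of the integers `n` such that `H_n(G, N)` is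
nonzero for some unitary left `RG`-module `N`. -/
noncomputable def homologicalDimension : ℕ∞ :=
  ⨆ n ∈ {n : ℕ | ∃ N : ModuleCat.{max u v} (AdjoinUnit (GroupoidAlgebra R G)),
    IsUnitaryLeft (GroupoidAlgebra R G) N ∧
      ¬ IsZero (groupoidHomology G n (underlyingIntModule R G N))}, (n : ℕ∞)

end Algebra

/-! For f in RG let ε(f) be its augmentation, the sum of the values of f over each source fibre. The
crux is a flatness statement, `exists_annihilator`: if ε(a) = 0, then some u in RG satisfies ua = 0
and ε(u) = 1_K, with K a compact open set of units as large as desired.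

To find u, put N = RG/RGa and take a projective resolution P of ℤG⁰. By projectivity P₀ → ℤG⁰ lifts
along ε to P₀ → ℤG; let ψ be the composite with ℤG → RG. If x in P₀ lies over 1_K with K large, then
modulo boundaries x ⊗ a depends only on ε(a) = 0, so it comes from some w in P₁ ⊗ RG
(`exists_boundary`). As a vanishes in N, w becomes a 1-cycle of P ⊗ N, hence a boundary because
H₁(G, N) = 0. The map y ⊗ b ↦ ψ(dy)b on P₁ ⊗ N is well defined modulo the elements va with ε(v) = 0
and kills boundaries. Hence ψ(x)a = va for such a v (`mul_mem_of_tensor_exact`), and u = ψ(x) - v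
works.

Iteration gives one u that annihilates finitely many elements 1_U - 1_{s(U)}, where the bisections U
cover a quasi-compact open set W. This means u(hg) = u(h) whenever g lies in W (`exists_invariant`),
while u still sums to one over every source fibre in K.

Both assertions follow from such a u. A finite subgroup F of the isotropy group at x acts freely on
the arrows with source x, and u is constant on the orbits, so 1 is |F| times an element of R. For
the subgroupoids, let W be symmetric with enough units. If u(k) ≠ 0 and k has source x, then g ↦
kg⁻¹ injects the arrows with source x in any power of W into the support of u in one range fibre.
The size of that support is bounded independently of x and of the power, so the powers of W become
stationary uniformly, and the stationary power is a quasi-compact open subgroupoid. -/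

/-! ## Modules over rings with local units -/

namespace AdjoinUnit

variable (A : Type u) [NonUnitalRing A]

/-- A ring acts on itself from the left. -/
noncomputable instance leftRegular : Module (AdjoinUnit A) A :=
  Module.compHom A (lift
    { toFun := AddMonoidHom.mulLeft
      map_mul' := fun a b => AddMonoidHom.ext fun c => mul_assoc a b c
      map_zero' := AddMonoidHom.ext fun c => zero_mul c
      map_add' := fun a b => AddMonoidHom.ext fun c => add_mul a b c } :
    AdjoinUnit A →+* AddMonoid.End A)

/-- A ring acts on itself from the right. -/
noncomputable instance rightRegular : Module (AdjoinUnit A)ᵐᵒᵖ A :=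
  Module.compHom A ((RingEquiv.opOp (AddMonoid.End A)).symm.toRingHom.comp
    (RingHom.op (lift
    { toFun := fun a => op (AddMonoidHom.mulRight a)
      map_mul' := fun a b => unop_injective <| AddMonoidHom.ext fun c => (mul_assoc c a b).symm
      map_zero' := unop_injective <| AddMonoidHom.ext fun c => mul_zero c
      map_add' := fun a b => unop_injective <| AddMonoidHom.ext fun c => mul_add c a b } :
    AdjoinUnit A →+* (AddMonoid.End A)ᵐᵒᵖ)))

variable {A}

lemma incl_smul (a b : A) : incl a • b = a * b := by
  change (lift _ (incl a) : AddMonoid.End A) b = _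
  rw [lift_incl]
  rfl

lemma op_incl_smul (a b : A) : op (incl a) • b = b * a := by
  change (unop (lift _ (incl a) : (AddMonoid.End A)ᵐᵒᵖ)) b = _
  rw [lift_incl]
  rfl

lemma map_incl {B : Type v} [NonUnitalRing B] (φ : A →ₙ+* B) (a : A) :
    map φ (incl a) = incl (φ a) :=
  lift_incl _ a

/-- A right `ℤ ⊕ A`-linear map from an additive map that is `A`-linear. -/
def linearMapOfOp {X Y : Type*} [AddCommGroup X] [AddCommGroup Y] [Module (AdjoinUnit A)ᵐᵒᵖ X]
    [Module (AdjoinUnit A)ᵐᵒᵖ Y] (f : X →+ Y)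
    (h : ∀ (a : A) (x : X), f (op (incl a) • x) = op (incl a) • f x) :
    X →ₗ[(AdjoinUnit A)ᵐᵒᵖ] Y where
  toFun := f
  map_add' := map_add f
  map_smul' b x := by
    obtain ⟨n, a, hb⟩ := exists_eq (unop b)
    have : b = ((n : ℤ) : (AdjoinUnit A)ᵐᵒᵖ) + op (incl a) := unop_injective (by simpa using hb)
    rw [this, RingHom.id_apply, add_smul, add_smul, map_add, h, Int.cast_smul_eq_zsmul,
      Int.cast_smul_eq_zsmul, map_zsmul]

/-- The left ideal `A a`. -/
def principalLeft (a : A) : Submodule (AdjoinUnit A) A where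
  carrier := {b | ∃ c, b = c * a}
  add_mem' := by
    rintro _ _ ⟨c, rfl⟩ ⟨d, rfl⟩
    exact ⟨c + d, (add_mul c d a).symm⟩
  zero_mem' := ⟨0, (zero_mul a).symm⟩
  smul_mem' := by
    rintro x _ ⟨c, rfl⟩
    obtain ⟨n, b, rfl⟩ := exists_eq x
    exact ⟨n • c + b * c, by
      rw [add_smul, Int.cast_smul_eq_zsmul, incl_smul, add_mul, smul_mul_assoc, mul_assoc]⟩

variable [HasLocalUnits A]

/-- This makes the quotient of `A` by a principal left ideal an admissible coefficient module. -/
lemma isUnitaryLeft_quotient (I : Submodule (AdjoinUnit A) A) : IsUnitaryLeft A (A ⧸ I) := by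
  refine (AddSubgroup.eq_top_iff' _).2 fun y => ?_
  obtain ⟨b, rfl⟩ := I.mkQ_surjective y
  obtain ⟨e, -, he⟩ := HasLocalUnits.exists_idem {b}
  refine AddSubgroup.subset_closure ⟨e, I.mkQ b, ?_⟩
  rw [← map_smul, incl_smul, (he b (by simp)).1]

lemma isUnitaryRight_self : IsUnitaryRight A A :=
  IsUnitaryRight.of_forall fun a => by
    obtain ⟨e, -, he⟩ := HasLocalUnits.exists_idem {a}
    exact ⟨e, by rw [op_incl_smul, (he a (by simp)).2]⟩

end AdjoinUnit

/-! ### Exactness in the category of unitary right modules -/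

namespace UnitaryRightMod

variable {A : Type u} [NonUnitalRing A] [HasLocalUnits A]

lemma surjective_of_epi {X Y : UnitaryRightMod A} (f : X ⟶ Y) [Epi f] :
    Function.Surjective f.hom.hom := by
  have := (unitaryRight A).preservesEpimorphisms_ι_of_isNormalMonoCategory
  exact (ModuleCat.epi_iff_surjective f.hom).1
    (inferInstanceAs (Epi ((unitaryRight A).ι.map f)))

lemma epi_of_surjective {X Y : UnitaryRightMod A} (f : X ⟶ Y)
    (h : Function.Surjective f.hom.hom) : Epi f :=
  (unitaryRight A).ι.epi_of_epi_map ((ModuleCat.epi_iff_surjective f.hom).2 h)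

/-- Submodules of unitary modules are unitary, so the module-theoretic kernel of `S.g` is an object
of the category. Exactness up to refinement along an epimorphism, which is surjective, then yields
the element. -/
lemma exists_preimage_of_exact {S : ShortComplex (UnitaryRightMod A)} (hS : S.Exact)
    (x : S.X₂.obj) (hx : S.g.hom.hom x = 0) : ∃ y : S.X₁.obj, S.f.hom.hom y = x := by
  let K : ModuleCat.{u} (AdjoinUnit A)ᵐᵒᵖ := ModuleCat.of _ (LinearMap.ker S.g.hom.hom)
  let i : K ⟶ S.X₂.obj := ModuleCat.ofHom (LinearMap.ker S.g.hom.hom).subtype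
  have hi : Mono i := (ModuleCat.mono_iff_injective i).2 Subtype.val_injective
  let K' : UnitaryRightMod A := ⟨K, (unitaryRight A).prop_of_mono i S.X₂.property⟩
  let j : K' ⟶ S.X₂ := ObjectProperty.homMk i
  have hj : j ≫ S.g = 0 := by
    apply (unitaryRight A).ι.map_injective
    apply ModuleCat.hom_ext
    ext y
    exact y.2
  obtain ⟨A', π, hπ, k, hk⟩ := S.exact_iff_exact_up_to_refinements.1 hS j hj
  obtain ⟨z, hz⟩ := surjective_of_epi π ⟨x, hx⟩
  refine ⟨k.hom.hom z, ?_⟩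
  have h1 := congrArg (fun f => f.hom.hom z) hk
  exact h1.symm.trans (congrArg Subtype.val hz)

/-- The derived functor may be computed from the resolution `P`, so its vanishing in degree one is
exactness of the tensored complex there. -/
lemma exists_tensor_preimage {X : UnitaryRightMod A} (P : ProjectiveResolution X)
    {N : Type w} [AddCommGroup N] [Module (AdjoinUnit A) N] (h : IsZero (unitaryTor A 1 X N))
    (t : BalancedTensor A (P.complex.X 1).obj N)
    (ht : BalancedTensor.map A N (P.complex.d 1 0).hom.hom t = 0) :
    ∃ s, BalancedTensor.map A N (P.complex.d 2 1).hom.hom s = t := by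
  have h1 := h.of_iso (P.isoLeftDerivedObj (tensorFunctor A N) 1).symm
  have h2 := (HomologicalComplex.exactAt_iff_isZero_homology _ 1).2 h1
  rw [HomologicalComplex.exactAt_iff' _ 2 1 0 (by simp) (by simp)] at h2
  exact (ShortComplex.ab_exact_iff _).1 h2 t ht

lemma exists_resolution_preimage {X : UnitaryRightMod A} (P : ProjectiveResolution X)
    (p : (P.complex.X 0).obj) (hp : (P.π.f 0).hom.hom p = 0) :
    ∃ q, (P.complex.d 1 0).hom.hom q = p :=
  exists_preimage_of_exact (S := ShortComplex.mk _ _ P.complex_d_comp_π_f_zero)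
    (ShortComplex.exact_of_g_is_cokernel _ P.isColimitCokernelCofork) p hp

end UnitaryRightMod

lemma BalancedTensor.smul_tmul {A : Type u} [NonUnitalRing A] {X : Type v} [AddCommGroup X]
    [Module (AdjoinUnit A)ᵐᵒᵖ X] {N : Type w} [AddCommGroup N] [Module (AdjoinUnit A) N]
    (x : X) (a : A) (n : N) :
    (QuotientAddGroup.mk ((op (incl a) • x) ⊗ₜ[ℤ] n) : BalancedTensor A X N) =
      QuotientAddGroup.mk (x ⊗ₜ[ℤ] (incl a • n)) := by
  rw [← sub_eq_zero, ← QuotientAddGroup.mk_sub, QuotientAddGroup.eq_zero_iff]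
  exact AddSubgroup.subset_closure ⟨x, a, n, rfl⟩

/-- The homomorphism from `X ⊗_A N` induced by a balanced biadditive map. -/
noncomputable def BalancedTensor.lift {A : Type u} [NonUnitalRing A] {X : Type v} [AddCommGroup X]
    [Module (AdjoinUnit A)ᵐᵒᵖ X] {N : Type w} [AddCommGroup N] [Module (AdjoinUnit A) N]
    {C : Type*} [AddCommGroup C] (f : X →+ N →+ C)
    (hf : ∀ x (a : A) n, f (op (incl a) • x) n = f x (incl a • n)) : BalancedTensor A X N →+ C :=
  QuotientAddGroup.lift (balancedRel A X N)
    (TensorProduct.liftAddHom f fun r x n => by simp) (by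
      refine (AddSubgroup.closure_le _).2 ?_
      rintro _ ⟨x, a, n, rfl⟩
      change _ = _
      rw [map_sub, TensorProduct.liftAddHom_tmul, TensorProduct.liftAddHom_tmul, hf, sub_self])

/-! ## The augmentation -/

section Augmentation

variable {G : Type u} [Groupoid.{u} G] {R : Type v} [Ring R]

/-- The sum of the values of a function of arrows over the source fibres. -/
noncomputable def augmentation (f : Arrows G → R) : G → R := unitAction (fun _ => 1) f

/-- The extension of a function of units by zero to all arrows. -/
noncomputable def unitExtend (h : G → R) : Arrows G → R :=
  (Set.range Arrows.unit).indicator fun γ => h γ.left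

lemma unitExtend_indicator (K : Set G) (r : R) :
    unitExtend (K.indicator fun _ => r) = (Arrows.unit '' K).indicator fun _ => r := by
  ext γ
  by_cases h : γ ∈ Set.range (Arrows.unit : G → Arrows G)
  · obtain ⟨x, rfl⟩ := h
    have : Arrows.unit x ∈ Arrows.unit '' K ↔ x ∈ K :=
      ⟨fun ⟨z, hz, e⟩ => by cases e; exact hz, fun h => ⟨x, h, rfl⟩⟩
    rw [unitExtend, Set.indicator_of_mem (Set.mem_range_self x)]
    by_cases hx : x ∈ K
    · rw [Set.indicator_of_mem (this.2 hx)]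
      exact Set.indicator_of_mem hx _
    · rw [Set.indicator_of_notMem (mt this.1 hx)]
      exact Set.indicator_of_notMem hx _
  · have h' : γ ∉ Arrows.unit '' K := fun ⟨x, _, e⟩ => h ⟨x, e⟩
    rw [unitExtend, Set.indicator_of_notMem h, Set.indicator_of_notMem h']

lemma unitExtend_add (h k : G → R) : unitExtend (h + k) = unitExtend h + unitExtend k :=
  Set.indicator_add _ _ _

lemma unitExtend_zero : unitExtend (0 : G → R) = 0 := Set.indicator_zero _ _

lemma unitAction_congr {h h' : G → R} {f : Arrows G → R}
    (H : ∀ γ : Arrows G, f γ ≠ 0 → h γ.right = h' γ.right) : unitAction h f = unitAction h' f := by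
  ext x
  refine finsum_congr fun g => ?_
  by_cases hg : f ⟨x, g.1, g.2⟩ = 0
  · rw [hg, mul_zero, mul_zero]
  · rw [H _ hg]

/-- The constant function one need not belong to the span of compact open sets. On a fixed `f` it
can be replaced by the characteristic function of a large compact open set, which makes the module
axioms available. -/
lemma unitAction_indicator_eq_augmentation {K : Set G} {f : Arrows G → R}
    (H : ∀ γ : Arrows G, f γ ≠ 0 → γ.right ∈ K) :
    unitAction (K.indicator fun _ => 1) f = augmentation f :=
  unitAction_congr fun γ hγ => Set.indicator_of_mem (H γ hγ) _

lemma augmentation_zero : augmentation (0 : Arrows G → R) = 0 := unitAction_zero _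

lemma Arrows.setMul_unit_source (V : Set (Arrows G)) :
    Arrows.setMul V (Arrows.unit '' ((fun g : Arrows G => g.left) '' V)) = V := by
  ext γ
  rw [Arrows.mem_setMul_iff]
  constructor
  · rintro ⟨⟨x, y, g⟩, hg, _, ⟨z, -, rfl⟩, e, rfl⟩
    obtain rfl : z = x := e
    simpa [Arrows.mul, Arrows.unit] using hg
  · intro h
    exact ⟨γ, h, _, ⟨γ.left, ⟨γ, h, rfl⟩, rfl⟩, rfl, by simp [Arrows.mul, Arrows.unit]⟩

lemma Arrows.image_left_unit (K : Set G) :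
    (fun g : Arrows G => g.left) '' (Arrows.unit '' K) = K := by
  rw [Set.image_image]
  exact Set.image_id K

end Augmentation

/-! ### The augmentation on spans of compact open sets -/

namespace AmpleGroupoid

variable {G : Type u} [Groupoid.{u} G] [TopologicalSpace G] [TopologicalSpace (Arrows G)]
  {R : Type v} [Ring R]

lemma setAct_eq_image {K : Set G} {V : Set (Arrows G)} (h : ∀ g ∈ V, g.right ∈ K) :
    setAct K V = (fun g : Arrows G => g.left) '' V := by
  have : V ∩ (fun g : Arrows G => g.right) ⁻¹' K = V := Set.inter_eq_left.2 h
  rw [setAct, this]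

lemma IsCompactBisection.augmentation_indicator {V : Set (Arrows G)} (hV : IsCompactBisection V)
    (r : R) : augmentation (V.indicator fun _ => r) =
      ((fun g : Arrows G => g.left) '' V).indicator fun _ => r := by
  have h := hV.unitAction_indicator Set.univ 1 r
  rwa [Set.indicator_univ, one_mul, setAct_eq_image fun _ _ => Set.mem_univ _] at h

variable [AmpleGroupoid G]

attribute [local instance] locallyCompactSpace t2Space totallyDisconnectedSpace

lemma indicator_units_mem {K : Set G} (hK : IsOpen K) (hK' : IsCompact K) (r : R) :
    (K.indicator fun _ => r) ∈ compactOpenSpan R G :=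
  indicator_mem_compactOpenSpan hK hK' inferInstance r

lemma augmentation_add {f g : Arrows G → R} (hf : f ∈ compactOpenSpan R (Arrows G))
    (hg : g ∈ compactOpenSpan R (Arrows G)) :
    augmentation (f + g) = augmentation f + augmentation g :=
  unitAction_add (fiberFinite hf) (fiberFinite hg) _

lemma augmentation_mem {f : Arrows G → R} (hf : f ∈ compactOpenSpan R (Arrows G)) :
    augmentation f ∈ compactOpenSpan R G := by
  obtain ⟨K, hK, hK', h⟩ := exists_unit_support hf
  rw [← unitAction_indicator_eq_augmentation fun γ hγ => (h γ hγ).2]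
  exact unitAction_mem (indicator_units_mem hK hK' 1) hf

/-- With one compact open set that contains the ranges of the supports of both `f` and `f * g`, this
is associativity of the action on its characteristic function. -/
lemma augmentation_convolution {f g : Arrows G → R} (hf : f ∈ compactOpenSpan R (Arrows G))
    (hg : g ∈ compactOpenSpan R (Arrows G)) :
    augmentation (convolution f g) = unitAction (augmentation f) g := by
  obtain ⟨K, hK, hK', h⟩ := exists_unit_support hf
  obtain ⟨L, hL, hL', h'⟩ := exists_unit_support (convolution_mem hf hg)
  rw [← unitAction_indicator_eq_augmentation (K := K ∪ L) fun γ hγ => Or.inr (h' γ hγ).2,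
    ← unitAction_indicator_eq_augmentation (K := K ∪ L) fun γ hγ => Or.inl (h γ hγ).2,
    unitAction_convolution (indicator_units_mem (hK.union hL) (hK'.union hL') 1) hf hg]

lemma intCast_augmentation {f : Arrows G → ℤ} (hf : f ∈ compactOpenSpan ℤ (Arrows G)) :
    augmentation (fun γ => (f γ : R)) = fun x => ((augmentation f x : ℤ) : R) := by
  ext x
  simp only [augmentation, unitAction]
  have hfin : (Function.support fun g : Σ y : G, x ⟶ y =>
      (1 : ℤ) * f ⟨x, g.1, g.2⟩).Finite :=
    ((fiberFinite hf).2 x).subset fun a ha => right_ne_zero_of_mul ha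
  simpa using (AddMonoidHom.map_finsum (Int.castAddHom R) hfin).symm

end AmpleGroupoid

/-! ### The augmentation of the groupoid algebra and boundaries -/

namespace GroupoidAlgebra

open AmpleGroupoid

variable {R : Type v} [Ring R] {G : Type u} [Groupoid.{u} G] [TopologicalSpace G]
  [TopologicalSpace (Arrows G)] [AmpleGroupoid G]

/-- A multiple of the characteristic function of a compact bisection, as an element of `RG`. -/
noncomputable def bisection {U : Set (Arrows G)} (hU : IsCompactBisection U) (r : R) :
    GroupoidAlgebra R G :=
  ⟨U.indicator fun _ => r, hU.indicator_mem r⟩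

lemma induction {p : GroupoidAlgebra R G → Prop} (zero : p 0)
    (add : ∀ a b, p a → p b → p (a + b))
    (single : ∀ (V : Set (Arrows G)) (hV : IsCompactBisection V) (r : R), p (bisection hV r))
    (a : GroupoidAlgebra R G) : p a := by
  obtain ⟨f, hf⟩ := a
  induction hf using bisection_induction with
  | zero => exact zero
  | add f hf g hg h1 h2 => exact add ⟨f, hf⟩ ⟨g, hg⟩ h1 h2
  | ind V hV r => exact single V hV r

lemma augmentation_add' (a b : GroupoidAlgebra R G) :
    augmentation (a + b).1 = augmentation a.1 + augmentation b.1 :=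
  augmentation_add a.2 b.2

lemma augmentation_mul (a b : GroupoidAlgebra R G) :
    augmentation (a * b).1 = unitAction (augmentation a.1) b.1 :=
  augmentation_convolution a.2 b.2

lemma ofInt_bisection {U : Set (Arrows G)} (hU : IsCompactBisection U) :
    ofInt R (bisection hU 1) = bisection hU 1 := by
  apply ext
  funext γ
  change ((U.indicator (fun _ => (1 : ℤ)) γ : ℤ) : R) = U.indicator (fun _ => 1) γ
  by_cases h : γ ∈ U <;> simp [h]

/-- The set `V` is tied to `U` by an equation so that the lemma also covers `U = V`, a set of units.
-/
lemma bisection_mul_unit {U V : Set (Arrows G)} (hU : IsCompactBisection U)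
    (hV : IsCompactBisection V) (h : V = Arrows.unit '' ((fun g : Arrows G => g.left) '' U))
    (r : R) : bisection hU 1 * bisection hV r = bisection hU r := by
  subst h
  apply ext
  refine (hU.convolution_indicator _ 1 r).trans ?_
  rw [one_mul, Arrows.setMul_unit_source]
  rfl

variable (G) in
/-- `ℤG` as a unitary right module over itself. -/
noncomputable def regularModule : UnitaryRightMod (GroupoidAlgebra ℤ G) :=
  ⟨ModuleCat.of _ (GroupoidAlgebra ℤ G), AdjoinUnit.isUnitaryRight_self⟩

variable (G) in
/-- The augmentation `ℤG → ℤG⁰`. -/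
noncomputable def augmentationHom : regularModule G ⟶ trivialModule G :=
  ObjectProperty.homMk (ModuleCat.ofHom (AdjoinUnit.linearMapOfOp (A := GroupoidAlgebra ℤ G)
    (X := GroupoidAlgebra ℤ G) (Y := UnitFunctions G)
    { toFun := fun a => ⟨augmentation a.1, augmentation_mem a.2⟩
      map_zero' := Subtype.ext augmentation_zero
      map_add' := fun a b => Subtype.ext (augmentation_add a.2 b.2) }
    fun a x => Subtype.ext (by
      rw [AdjoinUnit.op_incl_smul, UnitFunctions.smul_val]
      exact augmentation_convolution x.2 a.2)))

/-- Characteristic functions lift to functions supported on units, and the augmentation is additive.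
-/
lemma exists_augmentation_eq {h : G → R} (hh : h ∈ compactOpenSpan R G) :
    ∃ a : GroupoidAlgebra R G, augmentation a.1 = h := by
  induction hh using compactOpenSpan_induction with
  | zero => exact ⟨0, augmentation_zero⟩
  | add f _ g _ hf hg =>
    obtain ⟨a, rfl⟩ := hf
    obtain ⟨b, rfl⟩ := hg
    exact ⟨a + b, augmentation_add a.2 b.2⟩
  | ind U h1 h2 _ r =>
    refine ⟨bisection (isCompactBisection_unit h1 h2) r, ?_⟩
    refine ((isCompactBisection_unit h1 h2).augmentation_indicator r).trans ?_
    rw [Arrows.image_left_unit]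

instance : Epi (augmentationHom G) :=
  UnitaryRightMod.epi_of_surjective _ fun h => by
    obtain ⟨a, ha⟩ := exists_augmentation_eq h.2
    exact ⟨a, Subtype.ext ha⟩

/-- Modulo the kernel of a surjection `π : X₀ → ℤG⁰`, an element `f` of `RG` acts on a lift of the
characteristic function of a large compact open set of units as its augmentation does. -/
lemma exists_boundary {X₀ X₁ D : Type*} [AddCommGroup X₀] [AddCommGroup X₁] [AddCommGroup D]
    [Module (AdjoinUnit (GroupoidAlgebra ℤ G))ᵐᵒᵖ X₀] (d : X₁ →+ X₀)
    (π : X₀ →ₗ[(AdjoinUnit (GroupoidAlgebra ℤ G))ᵐᵒᵖ] UnitFunctions G)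
    (hπ : ∀ x, π x = 0 → ∃ y, d y = x) (F : X₀ →+ GroupoidAlgebra R G →+ D)
    (hF : ∀ x a b, F (op (incl a) • x) b = F x (ofInt R a * b)) (f : GroupoidAlgebra R G) :
    ∃ c : GroupoidAlgebra R G, c.1 = unitExtend (augmentation f.1) ∧
      ∃ K₀ : Set G, IsOpen K₀ ∧ IsCompact K₀ ∧ ∀ K, K₀ ⊆ K → ∀ x,
        (π x).1 = K.indicator (fun _ => 1) → ∃ w : X₁ ⊗[ℤ] GroupoidAlgebra R G,
          TensorProduct.liftAddHom (F.comp d) (fun r x n => by simp) w = F x f - F x c := by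
  induction f using GroupoidAlgebra.induction with
  | zero =>
    refine ⟨0, ?_, ∅, isOpen_empty, isCompact_empty, fun K _ x _ => ⟨0, ?_⟩⟩
    · exact (unitExtend_zero.symm.trans (congrArg unitExtend augmentation_zero.symm))
    · rw [map_zero, map_zero, sub_zero]
  | add f g h1 h2 =>
    obtain ⟨c, hc, K, hK, hK', h⟩ := h1
    obtain ⟨c', hc', L, hL, hL', h'⟩ := h2
    refine ⟨c + c', ?_, K ∪ L, hK.union hL, hK'.union hL', fun M hM x hx => ?_⟩
    · rw [augmentation_add', unitExtend_add, ← hc, ← hc']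
      rfl
    · obtain ⟨w, hw⟩ := h M (Set.subset_union_left.trans hM) x hx
      obtain ⟨w', hw'⟩ := h' M (Set.subset_union_right.trans hM) x hx
      refine ⟨w + w', ?_⟩
      rw [map_add, hw, hw', map_add, map_add, add_sub_add_comm]
  | single V hV r =>
    have hL : IsOpen ((fun g : Arrows G => g.left) '' V) :=
      isLocalHomeomorph_source.isOpenMap V hV.isOpen
    have hL' : IsCompact ((fun g : Arrows G => g.left) '' V) := hV.isCompact.image continuous_source
    have hE := isCompactBisection_unit hL hL'
    refine ⟨bisection hE r, ?_,
      (fun g : Arrows G => g.left) '' V ∪ (fun g : Arrows G => g.right) '' V,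
      hL.union (isLocalHomeomorph_range.isOpenMap V hV.isOpen),
      hL'.union (hV.isCompact.image continuous_range), fun K hK x hx => ?_⟩
    · change _ = unitExtend (augmentation (V.indicator fun _ => r))
      rw [hV.augmentation_indicator, unitExtend_indicator]
      rfl
    -- With E the units over s(V), the elements x·1_V and x·1_E both lie over 1_{s(V)}, because `K`
    -- contains the ranges and the sources of `V`. Their difference is therefore a boundary.
    · obtain ⟨y, hy⟩ := hπ (op (incl (bisection (R := ℤ) hV 1)) • x -
          op (incl (bisection (R := ℤ) hE 1)) • x) (by
        rw [map_sub, map_smul, map_smul, sub_eq_zero]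
        refine Subtype.ext ((UnitFunctions.smul_val _ _ _).trans
          (Eq.trans ?_ (UnitFunctions.smul_val _ _ _).symm))
        rw [hx]
        refine (hV.unitAction_indicator K 1 1).trans ((hE.unitAction_indicator K 1 1).trans ?_).symm
        rw [setAct_eq_image, setAct_eq_image, Arrows.image_left_unit]
        · exact fun g hg => hK (Or.inr ⟨g, hg, rfl⟩)
        · rintro _ ⟨z, hz, rfl⟩
          exact hK (Or.inl hz))
      -- Balancing moves 1_V and 1_E to the second argument, where 1_V * r1_E = r1_V and 1_E * r1_E
      -- = r1_E.
      refine ⟨y ⊗ₜ bisection hE r, ?_⟩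
      rw [TensorProduct.liftAddHom_tmul, AddMonoidHom.comp_apply, hy, map_sub,
        AddMonoidHom.sub_apply, hF, hF, ofInt_bisection, ofInt_bisection,
        bisection_mul_unit hV hE rfl, bisection_mul_unit hE hE (by rw [Arrows.image_left_unit])]

end GroupoidAlgebra

/-! ## Consequences of the vanishing of the first homology -/

section Tensor

variable {A : Type u} [NonUnitalRing A] {B : Type v} [NonUnitalRing B] (f : A →ₙ+* B)
  {X₀ X₁ X₂ : Type u} [AddCommGroup X₀] [AddCommGroup X₁] [AddCommGroup X₂]
  [Module (AdjoinUnit A)ᵐᵒᵖ X₀] [Module (AdjoinUnit A)ᵐᵒᵖ X₁] [Module (AdjoinUnit A)ᵐᵒᵖ X₂]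
  {N : Type w} [AddCommGroup N] [Module (AdjoinUnit A) N] (m : B →+ N)

/-- The pairing `(x, b) ↦ (x ⊗ m b, ψ x * b)`. -/
def tensorAndProduct (ψ : X₀ →+ B) : X₀ →+ B →+ BalancedTensor A X₀ N × B :=
  AddMonoidHom.mk' (fun x => AddMonoidHom.mk'
    (fun b => (QuotientAddGroup.mk (x ⊗ₜ m b), ψ x * b)) fun b c => by
      rw [map_add, TensorProduct.tmul_add, QuotientAddGroup.mk_add, mul_add]
      rfl) fun x y => AddMonoidHom.ext fun b => by
        change (QuotientAddGroup.mk ((x + y) ⊗ₜ m b), ψ (x + y) * b) = _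
        rw [TensorProduct.add_tmul, QuotientAddGroup.mk_add, map_add, add_mul]
        rfl

lemma tensorAndProduct_apply (ψ : X₀ →+ B) (x : X₀) (b : B) : tensorAndProduct (A := A) m ψ x b =
    (QuotientAddGroup.mk (x ⊗ₜ m b), ψ x * b) := rfl

/-- This is the balancing condition of `exists_boundary`. Pairing the two maps lets a single `w`
serve for the tensor product with `N` and for the product in `B`. -/
lemma tensorAndProduct_smul (hm : ∀ a b, incl a • m b = m (f a * b)) (ψ : X₀ →+ B)
    (hψ : ∀ x a, ψ (op (incl a) • x) = ψ x * f a) (x : X₀) (a : A) (b : B) :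
    tensorAndProduct (A := A) m ψ (op (incl a) • x) b = tensorAndProduct m ψ x (f a * b) := by
  rw [tensorAndProduct_apply, tensorAndProduct_apply, BalancedTensor.smul_tmul, hm, hψ, mul_assoc]

/-- The element `w` maps to `x ⊗ m a = 0` in `X₀ ⊗ N`, so its image in `X₁ ⊗ N` is a cycle, hence a
boundary. The map `y ⊗ m b ↦ ψ (d₁ y) * b` modulo `S` kills boundaries, but sends this image to the
class of `ψ x * a`. -/
lemma mul_mem_of_tensor_exact (hm' : Function.Surjective m)
    (hm : ∀ a b, incl a • m b = m (f a * b)) (d₂ : X₂ →ₗ[(AdjoinUnit A)ᵐᵒᵖ] X₁)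
    (d₁ : X₁ →ₗ[(AdjoinUnit A)ᵐᵒᵖ] X₀) (hd : ∀ z, d₁ (d₂ z) = 0)
    (hex : ∀ t, BalancedTensor.map A N d₁ t = 0 → ∃ s, BalancedTensor.map A N d₂ s = t)
    (ψ : X₀ →+ B) (hψ : ∀ x a, ψ (op (incl a) • x) = ψ x * f a) (S : AddSubgroup B)
    (hS : ∀ y b, m b = 0 → ψ (d₁ y) * b ∈ S) {x : X₀} {a : B} (ha : m a = 0) (w : X₁ ⊗[ℤ] B)
    (hw : TensorProduct.liftAddHom ((tensorAndProduct (A := A) m ψ).comp d₁.toAddMonoidHom)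
      (fun r x n => by simp) w = tensorAndProduct m ψ x a) :
    ψ x * a ∈ S := by
  -- By `hS` the map `b ↦ ψ (d₁ y) * b` modulo `S` vanishes on the kernel of `m`, so it descends to
  -- `N`.
  let g : X₁ → B →+ B ⧸ S := fun y =>
    (QuotientAddGroup.mk' S).comp (AddMonoidHom.mulLeft (ψ (d₁ y)))
  have hg : ∀ y, m.ker ≤ (g y).ker := fun y b hb => (QuotientAddGroup.eq_zero_iff _).2 (hS y b hb)
  obtain ⟨n, hn⟩ := hm'.hasRightInverse
  let θ₀ : X₁ → N →+ B ⧸ S := fun y => m.liftOfRightInverse n hn ⟨g y, hg y⟩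
  have hθ₀ : ∀ y b, θ₀ y (m b) = QuotientAddGroup.mk' S (ψ (d₁ y) * b) := fun y b =>
    m.liftOfRightInverse_comp_apply n hn ⟨g y, hg y⟩ b
  let θ : X₁ →+ N →+ B ⧸ S := AddMonoidHom.mk' θ₀ fun y z => AddMonoidHom.ext fun k => by
    obtain ⟨b, rfl⟩ := hm' k
    rw [AddMonoidHom.add_apply, hθ₀, hθ₀, hθ₀, map_add, map_add, add_mul, map_add]
  have hθ : ∀ y b, θ y (m b) = QuotientAddGroup.mk' S (ψ (d₁ y) * b) := hθ₀
  let Θ : BalancedTensor A X₁ N →+ B ⧸ S := BalancedTensor.lift θ fun y b k => by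
    obtain ⟨c, rfl⟩ := hm' k
    rw [hm, hθ, hθ, map_smul, hψ, mul_assoc]
  -- The two components of the pairing at `w` are the boundary of the image of `w` in `X₁ ⊗ N` and,
  -- modulo `S`, the value of `Θ` at that image.
  have key : ∀ w : X₁ ⊗[ℤ] B, ∀ hF',
      BalancedTensor.map A N d₁ (QuotientAddGroup.mk (LinearMap.lTensor _ m.toIntLinearMap w)) =
        (TensorProduct.liftAddHom ((tensorAndProduct (A := A) m ψ).comp d₁.toAddMonoidHom)
          hF' w).1 ∧
      Θ (QuotientAddGroup.mk (LinearMap.lTensor _ m.toIntLinearMap w)) =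
        QuotientAddGroup.mk' S (TensorProduct.liftAddHom
          ((tensorAndProduct (A := A) m ψ).comp d₁.toAddMonoidHom) hF' w).2 := by
    intro w hF'
    induction w using TensorProduct.induction_on with
    | zero => exact ⟨by simp, by simp⟩
    | tmul y b => exact ⟨rfl, hθ y b⟩
    | add y z hy hz =>
      rw [map_add, QuotientAddGroup.mk_add, map_add, map_add, map_add, hy.1, hy.2, hz.1, hz.2]
      exact ⟨rfl, (map_add _ _ _).symm⟩
  obtain ⟨ht, ht'⟩ := key w fun r x n => by simp
  rw [hw, tensorAndProduct_apply] at ht ht'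
  rw [ha, TensorProduct.tmul_zero, QuotientAddGroup.mk_zero] at ht
  obtain ⟨s, hs⟩ := hex _ ht
  have hΘ0 : Θ.comp (BalancedTensor.map A N d₂) = 0 := by
    refine BalancedTensor.hom_ext _ fun z k => ?_
    obtain ⟨b, rfl⟩ := hm' k
    refine (hθ (d₂ z) b).trans ?_
    rw [hd, map_zero, zero_mul, map_zero]
    rfl
  refine (QuotientAddGroup.eq_zero_iff _).1 ?_
  refine ht'.symm.trans ?_
  rw [← hs]
  exact congrArg (fun f => f s) hΘ0

end Tensor

/-! ### Annihilators of elements of augmentation zero -/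

section Homology

open AmpleGroupoid GroupoidAlgebra

variable {R : Type v} [Ring R] {G : Type u} [Groupoid.{u} G] [TopologicalSpace G]
  [TopologicalSpace (Arrows G)] [AmpleGroupoid G]

/-- A nonzero group in degree one would force the supremum to be at least one. -/
lemma isZero_homology_one (hG : homologicalDimension R G = 0)
    (N : ModuleCat.{max u v} (AdjoinUnit (GroupoidAlgebra R G)))
    (hN : IsUnitaryLeft (GroupoidAlgebra R G) N) :
    IsZero (groupoidHomology G 1 (underlyingIntModule R G N)) := by
  by_contra h
  have h1 : ((1 : ℕ) : ℕ∞) ≤ homologicalDimension R G :=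
    le_iSup₂_of_le (f := fun (n : ℕ) (_ : n ∈ {n : ℕ | ∃ N : ModuleCat.{max u v}
      (AdjoinUnit (GroupoidAlgebra R G)), IsUnitaryLeft (GroupoidAlgebra R G) N ∧
        ¬ IsZero (groupoidHomology G n (underlyingIntModule R G N))}) => (n : ℕ∞))
      1 ⟨N, hN, h⟩ le_rfl
  rw [hG] at h1
  simp at h1

lemma incl_smul_underlying (N : ModuleCat.{w} (AdjoinUnit (GroupoidAlgebra R G)))
    (a : GroupoidAlgebra ℤ G) (n : underlyingIntModule R G N) :
    incl a • n = (incl (ofInt R a) • (show N from n) : N) := by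
  change AdjoinUnit.map (ofInt R) (incl a) • (show N from n) = _
  rw [AdjoinUnit.map_incl]

lemma augmentation_ofInt (a : GroupoidAlgebra ℤ G) :
    augmentation (ofInt R a).1 = fun x => ((augmentation a.1 x : ℤ) : R) :=
  intCast_augmentation a.2

/-- The multiples `v a` of an element `a` of `RG` with `v` of augmentation zero. -/
def augmentationZeroMultiples (a : GroupoidAlgebra R G) : AddSubgroup (GroupoidAlgebra R G) where
  carrier := {b | ∃ c, augmentation c.1 = 0 ∧ b = c * a}
  add_mem' := by
    rintro _ _ ⟨c, hc, rfl⟩ ⟨d, hd, rfl⟩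
    exact ⟨c + d, by rw [augmentation_add', hc, hd, add_zero], (add_mul c d a).symm⟩
  zero_mem' := ⟨0, augmentation_zero, (zero_mul a).symm⟩
  neg_mem' := by
    rintro _ ⟨c, hc, rfl⟩
    refine ⟨-c, ?_, (neg_mul c a).symm⟩
    have h := augmentation_add' c (-c)
    rw [hc, zero_add, add_neg_cancel] at h
    exact h.symm.trans augmentation_zero

set_option maxHeartbeats 1000000 in
/-- If the first homology vanishes, then an element of augmentation zero is annihilated by an
element whose augmentation is the characteristic function of a large set of units. -/
theorem exists_annihilator (hG : homologicalDimension R G = 0) (a : GroupoidAlgebra R G)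
    (ha : augmentation a.1 = 0) {L : Set G} (hL : IsOpen L) (hL' : IsCompact L) :
    ∃ K, L ⊆ K ∧ IsOpen K ∧ IsCompact K ∧ ∃ u : GroupoidAlgebra R G,
      u * a = 0 ∧ augmentation u.1 = K.indicator fun _ => 1 := by
  let B := GroupoidAlgebra R G
  -- The kernel of the projection to the coefficient module consists of the multiples of `a`; this
  -- is what turns membership modulo `S` into an equation `ψ x * a = v * a`.
  let I : Submodule (AdjoinUnit B) B := AdjoinUnit.principalLeft a
  let N : ModuleCat.{max u v} (AdjoinUnit B) := ModuleCat.of _ (B ⧸ I)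
  have hN := isZero_homology_one hG N (AdjoinUnit.isUnitaryLeft_quotient I)
  let N' := underlyingIntModule R G N
  let m : B →+ N' := I.mkQ.toAddMonoidHom
  have hm : ∀ (b : GroupoidAlgebra ℤ G) (c : B), incl b • m c = m (ofInt R b * c) := by
    intro b c
    refine (incl_smul_underlying N b (I.mkQ c)).trans ?_
    rw [← AdjoinUnit.incl_smul]
    exact (I.mkQ.map_smul _ _).symm
  have hma : m a = 0 := by
    obtain ⟨e, -, he⟩ := HasLocalUnits.exists_idem {a}
    exact (Submodule.Quotient.mk_eq_zero I).2 ⟨e, (he a (by simp)).1.symm⟩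
  let P := projectiveResolution (trivialModule G)
  let π : (P.complex.X 0).obj →ₗ[(AdjoinUnit (GroupoidAlgebra ℤ G))ᵐᵒᵖ] UnitFunctions G :=
    (P.π.f 0).hom.hom
  let d := (P.complex.d 1 0).hom.hom
  have hπd : ∀ y, π (d y) = 0 := fun y =>
    congrArg (fun f => f.hom.hom y) P.complex_d_comp_π_f_zero
  have hπ : ∀ x, π x = 0 → ∃ y, d y = x := UnitaryRightMod.exists_resolution_preimage P
  -- a lift of `π` to `ℤG`
  let π' : P.complex.X 0 ⟶ trivialModule G := P.π.f 0
  let φ' : P.complex.X 0 ⟶ regularModule G := Projective.factorThru π' (augmentationHom G)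
  have hφ' : φ' ≫ augmentationHom G = π' := Projective.factorThru_comp _ _
  let φ : (P.complex.X 0).obj →ₗ[(AdjoinUnit (GroupoidAlgebra ℤ G))ᵐᵒᵖ] GroupoidAlgebra ℤ G :=
    φ'.hom.hom
  have hφ : ∀ x, augmentation (φ x).1 = (π x).1 := fun x =>
    congrArg (fun f => (f.hom.hom x : UnitFunctions G).1) hφ'
  have hφs : ∀ x b, φ (op (incl b) • x) = φ x * b := fun x b => by
    rw [map_smul, AdjoinUnit.op_incl_smul]
  let ψ : (P.complex.X 0).obj →+ B := (ofInt (G := G) R).toAddMonoidHom.comp φ.toAddMonoidHom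
  have hψs : ∀ x b, ψ (op (incl b) • x) = ψ x * ofInt R b := fun x b =>
    (congrArg (ofInt R) (hφs x b)).trans (map_mul (ofInt R) _ _)
  have hψ : ∀ x, augmentation (ψ x).1 = fun z => (((π x).1 z : ℤ) : R) := fun x => by
    rw [← hφ]
    exact augmentation_ofInt (φ x)
  have hψd : ∀ y, augmentation (ψ (d y)).1 = 0 := fun y => by
    rw [hψ, hπd]
    exact funext fun _ => Int.cast_zero
  let F := tensorAndProduct (A := GroupoidAlgebra ℤ G) m ψ
  obtain ⟨c, hc, K₀, hK₀, hK₀', h⟩ := exists_boundary d.toAddMonoidHom π hπ F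
    (tensorAndProduct_smul (ofInt R) m hm ψ hψs) a
  -- The comparison element depends only on the augmentation of `a`, which is zero.
  obtain rfl : c = 0 := GroupoidAlgebra.ext (by rw [hc, ha, unitExtend_zero]; rfl)
  have hK := hK₀.union hL
  have hK' := hK₀'.union hL'
  have hπ_surj : Function.Surjective π := by
    have : Epi π' := inferInstanceAs (Epi (P.π.f 0))
    exact UnitaryRightMod.surjective_of_epi π'
  obtain ⟨x, hx⟩ := hπ_surj ⟨(K₀ ∪ L).indicator fun _ => 1, indicator_units_mem hK hK' 1⟩
  have hx' : (π x).1 = (K₀ ∪ L).indicator fun _ => 1 := congrArg Subtype.val hx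
  obtain ⟨w, hw⟩ := h _ Set.subset_union_left x hx'
  rw [map_zero, sub_zero] at hw
  -- An element `b` with `m b = 0` is `c * a`, so `ψ (d y) * b = (ψ (d y) * c) * a`. The factor in
  -- parentheses has augmentation zero because `π ∘ d = 0`.
  obtain ⟨v, hv, hva⟩ := mul_mem_of_tensor_exact (ofInt R) m I.mkQ_surjective hm
    (P.complex.d 2 1).hom.hom d
    (fun z => congrArg (fun f => f.hom.hom z) (P.complex.d_comp_d 2 1 0))
    (UnitaryRightMod.exists_tensor_preimage P hN) ψ hψs (augmentationZeroMultiples a) (by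
      intro y b hb
      obtain ⟨c, rfl⟩ := (Submodule.Quotient.mk_eq_zero I).1 hb
      refine ⟨ψ (d y) * c, ?_, (mul_assoc _ _ _).symm⟩
      rw [augmentation_mul, hψd, zero_unitAction]) hma w hw
  refine ⟨K₀ ∪ L, Set.subset_union_right, hK, hK', ψ x - v, ?_, ?_⟩
  · rw [sub_mul, ← hva, sub_self]
  · have h1 := augmentation_add' (ψ x - v) v
    rw [sub_add_cancel, hv, add_zero] at h1
    rw [← h1, hψ, hx']
    funext z
    by_cases hz : z ∈ K₀ ∪ L
    · rw [Set.indicator_of_mem hz, Set.indicator_of_mem hz, Int.cast_one]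
    · rw [Set.indicator_of_notMem hz, Set.indicator_of_notMem hz, Int.cast_zero]

end Homology

/-! ### Functions invariant under right translation -/

section Annihilator

open AmpleGroupoid GroupoidAlgebra

variable {R : Type v} [Ring R] {G : Type u} [Groupoid.{u} G] [TopologicalSpace G]
  [TopologicalSpace (Arrows G)] [AmpleGroupoid G]

/-- Annihilators are found one at a time: if `u` kills the elements of `s` and `v` kills `u * a`,
then `v * u` kills them all. Enlarging the sets of units keeps the augmentations under control. -/
lemma exists_common_annihilator (hG : homologicalDimension R G = 0)
    (s : Finset (GroupoidAlgebra R G)) (hs : ∀ a ∈ s, augmentation a.1 = 0)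
    {L : Set G} (hL : IsOpen L) (hL' : IsCompact L) :
    ∃ K, L ⊆ K ∧ IsOpen K ∧ IsCompact K ∧ ∃ u : GroupoidAlgebra R G,
      (∀ a ∈ s, u * a = 0) ∧ augmentation u.1 = K.indicator fun _ => 1 := by
  classical
  induction s using Finset.induction_on generalizing L with
  | empty =>
    refine ⟨L, le_rfl, hL, hL', bisection (isCompactBisection_unit hL hL') 1, by simp, ?_⟩
    refine ((isCompactBisection_unit hL hL').augmentation_indicator 1).trans ?_
    rw [Arrows.image_left_unit]
  | insert a s _ ih =>
    obtain ⟨M, hM, hM', ha⟩ := exists_unit_support a.2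
    obtain ⟨K, hLK, hK, hK', u, hu, hu'⟩ := ih (fun b hb => hs b (Finset.mem_insert_of_mem hb))
      (hL.union hM) (hL'.union hM')
    obtain ⟨M', hM₁, hM₁', hsu⟩ := exists_unit_support u.2
    -- The augmentation of `u` is one on the ranges of the support of `a`, so `u * a` has the same
    -- augmentation as `a`, namely zero.
    obtain ⟨K₁, hK₁, -, -, v, hv, hv'⟩ := exists_annihilator hG (u * a) (by
      rw [augmentation_mul, hu', unitAction_indicator_eq_augmentation
        fun γ hγ => hLK (Or.inr (ha γ hγ).2)]
      exact hs a (Finset.mem_insert_self a s)) hM₁ hM₁'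
    refine ⟨K, Set.subset_union_left.trans hLK, hK, hK', v * u, fun b hb => ?_, ?_⟩
    · rw [mul_assoc]
      obtain rfl | hb := Finset.mem_insert.1 hb
      · exact hv
      · rw [hu b hb, mul_zero]
    · rw [augmentation_mul, hv', unitAction_indicator_eq_augmentation
        fun γ hγ => hK₁ (hsu γ hγ).2, hu']

/-- Only one factorisation of `g ≫ h` has its first arrow in `U`: that arrow has source `x`, and the
source map is injective on `U`. Right convolution by a bisection is thus translation. -/
lemma convolution_bisection_comp {U : Set (Arrows G)} (hU : IsCompactBisection U)
    (f : Arrows G → R) {x y z : G} (g : x ⟶ y) (h : y ⟶ z) (hg : (⟨x, y, g⟩ : Arrows G) ∈ U) :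
    convolution f (U.indicator fun _ => 1) ⟨x, z, g ≫ h⟩ = f ⟨y, z, h⟩ := by
  have e : (g ≫ h) ≫ inv h = g := by simp
  rw [convolution, finsum_eq_single _ ⟨y, h⟩]
  · change f ⟨y, z, h⟩ * U.indicator (fun _ => 1) ⟨x, y, (g ≫ h) ≫ inv h⟩ = _
    rw [e, Set.indicator_of_mem hg, mul_one]
  · rintro ⟨w, k⟩ hne
    have : (⟨x, w, (g ≫ h) ≫ inv k⟩ : Arrows G) ∉ U := fun hk => by
      have h1 := hU.source_inj hk hg rfl
      obtain rfl : w = y := congrArg (fun γ : Arrows G => γ.right) h1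
      have h2 : (g ≫ h) ≫ inv k = g := by simpa using h1
      rw [IsIso.comp_inv_eq] at h2
      exact hne (by rw [(cancel_epi g).1 h2])
    rw [Set.indicator_of_notMem this, mul_zero]

/-- There is a function of arrows that sums to one over many source fibres and is invariant
under right translation by a given quasi-compact open set of arrows. -/
lemma exists_invariant (hG : homologicalDimension R G = 0) {W : Set (Arrows G)} (hW : IsOpen W)
    (hW' : IsCompact W) {L : Set G} (hL : IsOpen L) (hL' : IsCompact L) :
    ∃ K, L ⊆ K ∧ ∃ u ∈ compactOpenSpan R (Arrows G), (augmentation u = K.indicator fun _ => 1) ∧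
      ∀ {x y z : G} (g : x ⟶ y) (h : y ⟶ z), (⟨x, y, g⟩ : Arrows G) ∈ W →
        u ⟨x, z, g ≫ h⟩ = u ⟨y, z, h⟩ := by
  classical
  choose U hU hgU hUW using fun g : W => exists_bisection_subset hW g.2
  obtain ⟨t, ht⟩ := hW'.elim_finite_subcover U (fun g => (hU g).isOpen)
    fun g hg => Set.mem_iUnion.2 ⟨⟨g, hg⟩, hgU _⟩
  have hE := fun g : W => isCompactBisection_unit
    (isLocalHomeomorph_source.isOpenMap (U g) (hU g).isOpen)
    ((hU g).isCompact.image continuous_source)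
  -- Both characteristic functions have augmentation 1_{s(U)}. Annihilation of their difference says
  -- that translation by `U` does not change `u`.
  let a : W → GroupoidAlgebra R G := fun g => bisection (hU g) 1 - bisection (hE g) 1
  have ha : ∀ g, augmentation (a g).1 = 0 := fun g => by
    have h1 := augmentation_add' (a g) (bisection (hE g) 1)
    have h2 : augmentation (bisection (R := R) (hU g) 1).1 =
        augmentation (bisection (R := R) (hE g) 1).1 :=
      ((hU g).augmentation_indicator 1).trans
        (((hE g).augmentation_indicator 1).trans (by rw [Arrows.image_left_unit])).symm
    rw [sub_add_cancel, h2] at h1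
    exact add_eq_right.1 h1.symm
  obtain ⟨K, hLK, -, -, u, hu, hu'⟩ := exists_common_annihilator hG (t.image a)
    (fun b hb => by
      obtain ⟨g, -, rfl⟩ := Finset.mem_image.1 hb
      exact ha g) hL hL'
  refine ⟨K, hLK, u.1, u.2, hu', fun {x y z} g h hg => ?_⟩
  obtain ⟨i, hi, hgi⟩ := Set.mem_iUnion₂.1 (ht hg)
  have h1 := hu (a i) (Finset.mem_image_of_mem a hi)
  rw [mul_sub, sub_eq_zero] at h1
  have h2 : convolution u.1 ((U i).indicator fun _ => 1) ⟨x, z, g ≫ h⟩ =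
      convolution u.1 ((Arrows.unit '' ((fun g : Arrows G => g.left) '' U i)).indicator
        fun _ => 1) ⟨x, z, g ≫ h⟩ := congrArg (fun b => b.1 ⟨x, z, g ≫ h⟩) h1
  rw [convolution_bisection_comp (hU i) _ g h hgi, convolution_unit_right,
    if_pos ⟨_, hgi, rfl⟩] at h2
  exact h2.symm

end Annihilator

/-! ## Finite isotropy groups -/

section Isotropy

variable {R : Type v} [Ring R] {G : Type u} [Groupoid.{u} G]

/-- The group `K` acts freely by precomposition on the arrows with source `x`, and `u` is constant
on the orbits. Summing over orbits first exhibits the total sum 1 as `Nat.card K` times an element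
of `R`. -/
lemma isUnit_card_of_invariant {x : G} (K : Subgroup (x ⟶ x)) [Finite K] (u : (Σ y : G, x ⟶ y) → R)
    (hu : u.support.Finite) (hinv : ∀ g ∈ K, ∀ (y : G) (h : x ⟶ y), u ⟨y, g ≫ h⟩ = u ⟨y, h⟩)
    (hsum : ∑ᶠ k, u k = 1) : IsUnit (Nat.card K : R) := by
  classical
  have := Fintype.ofFinite K
  -- The product of the isotropy group is `≫`, so precomposition is a left action.
  let act : MulAction K (Σ y : G, x ⟶ y) :=
    { smul := fun g k => ⟨k.1, g.1 ≫ k.2⟩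
      one_smul := fun k => by
        change (⟨k.1, 𝟙 x ≫ k.2⟩ : Σ y : G, x ⟶ y) = k
        rw [Category.id_comp]
      mul_smul := fun g h k => by
        change (⟨k.1, (g.1 ≫ h.1) ≫ k.2⟩ : Σ y : G, x ⟶ y) = ⟨k.1, g.1 ≫ h.1 ≫ k.2⟩
        rw [Category.assoc] }
  have husmul : ∀ (g : K) (k : Σ y : G, x ⟶ y), u (g • k) = u k := fun g k => hinv g g.2 _ _
  let q : (Σ y : G, x ⟶ y) → MulAction.orbitRel.Quotient K (Σ y : G, x ⟶ y) := Quotient.mk _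
  let S := hu.toFinset
  have hcoset : ∀ c ∈ S.image q,
      ∑ k ∈ S with q k = c, u k = (Nat.card K : R) * u c.out := by
    intro c hc
    obtain ⟨k₀, hk₀, rfl⟩ := Finset.mem_image.1 hc
    have hout : q (q k₀).out = q k₀ := Quotient.out_eq _
    have huq : ∀ k, q k = q k₀ → u k = u k₀ := fun k hk => by
      obtain ⟨g, rfl⟩ := MulAction.orbitRel_apply.1 (Quotient.exact hk)
      exact husmul g k₀
    -- By invariance the support of `u` contains the whole orbit of each of its points.
    have hS : (S.filter fun k => q k = q k₀) = Finset.univ.image fun g : K => g • k₀ := by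
      ext k
      simp only [Finset.mem_filter, Finset.mem_image, Finset.mem_univ, true_and]
      constructor
      · rintro ⟨-, hk⟩
        exact MulAction.orbitRel_apply.1 (Quotient.exact hk)
      · rintro ⟨g, rfl⟩
        refine ⟨hu.mem_toFinset.2 ?_, Quotient.sound (MulAction.orbitRel_apply.2 ⟨g, rfl⟩)⟩
        rw [Function.mem_support, husmul]
        exact hu.mem_toFinset.1 hk₀
    have hinj : Function.Injective fun g : K => g • k₀ := fun g h e => by
      have e' : (⟨k₀.1, g.1 ≫ k₀.2⟩ : Σ y : G, x ⟶ y) = ⟨k₀.1, h.1 ≫ k₀.2⟩ := e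
      exact Subtype.ext ((cancel_mono k₀.2).1 (eq_of_heq (Sigma.mk.inj e').2))
    rw [Finset.sum_congr rfl fun k hk => huq k (Finset.mem_filter.1 hk).2, Finset.sum_const, hS,
      Finset.card_image_of_injective _ hinj, Finset.card_univ, ← Nat.card_eq_fintype_card,
      nsmul_eq_mul, huq _ hout]
  have h1 : (Nat.card K : R) * ∑ c ∈ S.image q, u c.out = 1 := by
    rw [Finset.mul_sum, ← Finset.sum_congr rfl hcoset,
      Finset.sum_fiberwise_of_maps_to fun k hk => Finset.mem_image_of_mem q hk,
      ← finsum_eq_sum_of_support_toFinset_subset u hu le_rfl, hsum]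
  -- The ring may be noncommutative, but natural numbers are central, so the right inverse is
  -- two-sided.
  exact ⟨⟨_, _, h1, (Nat.cast_commute _ _).eq.symm.trans h1⟩, rfl⟩

end Isotropy

/-! ## Subgroupoids generated by sets of arrows -/

namespace Arrows

variable {G : Type u} [Groupoid.{u} G]

lemma comp_mem_setMul {U V : Set (Arrows G)} {x y z : G} {h : x ⟶ y} {g : y ⟶ z}
    (hh : (⟨x, y, h⟩ : Arrows G) ∈ V) (hg : (⟨y, z, g⟩ : Arrows G) ∈ U) :
    (⟨x, z, h ≫ g⟩ : Arrows G) ∈ setMul U V := by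
  refine ⟨⟨y, g⟩, hg, ?_⟩
  change (⟨x, y, (h ≫ g) ≫ inv g⟩ : Arrows G) ∈ V
  rwa [Category.assoc, IsIso.hom_inv_id, Category.comp_id]

lemma exists_comp_of_mem_setMul {U V : Set (Arrows G)} {x z : G} {k : x ⟶ z}
    (hk : (⟨x, z, k⟩ : Arrows G) ∈ setMul U V) : ∃ (y : G) (h : x ⟶ y) (g : y ⟶ z),
      (⟨x, y, h⟩ : Arrows G) ∈ V ∧ (⟨y, z, g⟩ : Arrows G) ∈ U ∧ k = h ≫ g := by
  obtain ⟨⟨y, g⟩, hg, hh⟩ := hk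
  exact ⟨y, k ≫ inv g, g, hh, hg, by simp⟩

/-- The products of `n + 1` elements of a set of arrows. -/
def setPow (W : Set (Arrows G)) : ℕ → Set (Arrows G)
  | 0 => W
  | n + 1 => setMul W (setPow W n)

variable {W : Set (Arrows G)}

/-- The index is one less than the number of factors: m + 1 and n + 1 factors make m + n + 2. -/
lemma setMul_setPow (m n : ℕ) : setMul (setPow W m) (setPow W n) = setPow W (m + n + 1) := by
  induction m with
  | zero => rw [Nat.zero_add]; rfl
  | succ m ih =>
    rw [setPow, setMul_assoc, ih, show m + 1 + n + 1 = (m + n + 1) + 1 by omega]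
    rfl

lemma inv_mem_setPow (hW : ∀ γ ∈ W, γ.inverse ∈ W) {n : ℕ} {x y : G} {g : x ⟶ y}
    (hg : (⟨x, y, g⟩ : Arrows G) ∈ setPow W n) : (⟨y, x, inv g⟩ : Arrows G) ∈ setPow W n := by
  induction n generalizing x y with
  | zero => exact hW _ hg
  | succ n ih =>
    obtain ⟨z, h, k, hh, hk, rfl⟩ := exists_comp_of_mem_setMul hg
    -- Inversion reverses the factors, so the factor from `W` must be split off on the other side.
    have e : setMul (setPow W n) (setPow W 0) = setPow W (n + 1) := setMul_setPow n 0
    rw [IsIso.inv_comp, ← e]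
    exact comp_mem_setMul (hW _ hk) (ih hh)

lemma unit_mem_of_mem_setPow (hW : ∀ γ ∈ W, unit γ.right ∈ W) {n : ℕ} {γ : Arrows G}
    (hγ : γ ∈ setPow W n) : unit γ.right ∈ W := by
  cases n with
  | zero => exact hW _ hγ
  | succ n =>
    obtain ⟨x, y, k⟩ := γ
    obtain ⟨z, h, g, hh, hg, rfl⟩ := exists_comp_of_mem_setMul hγ
    exact hW ⟨z, y, g⟩ hg

lemma setPow_mono (hW : ∀ γ ∈ W, unit γ.right ∈ W) : Monotone (setPow W) := by
  refine monotone_nat_of_le_succ fun n => ?_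
  rintro ⟨x, y, g⟩ hg
  have h := comp_mem_setMul hg (unit_mem_of_mem_setPow hW hg)
  rw [Category.comp_id] at h
  exact h

/-- If the number of arrows with a given source in the powers of `W` is bounded, then the powers
become stationary. -/
lemma setPow_subset_of_ncard_le (hW : ∀ γ ∈ W, unit γ.right ∈ W) {b : ℕ}
    (hb : ∀ n (x : G), {a : Σ y : G, x ⟶ y | (⟨x, a.1, a.2⟩ : Arrows G) ∈ setPow W n}.Finite ∧
      {a : Σ y : G, x ⟶ y | (⟨x, a.1, a.2⟩ : Arrows G) ∈ setPow W n}.ncard ≤ b) (n : ℕ) :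
    setPow W n ⊆ setPow W b := by
  obtain h | h := le_total n b
  · exact setPow_mono hW h
  rintro ⟨x, y, g⟩ hg
  let S : ℕ → Set (Σ y : G, x ⟶ y) := fun n => {a | (⟨x, a.1, a.2⟩ : Arrows G) ∈ setPow W n}
  have hS : Monotone S := fun m n hmn a ha => setPow_mono hW hmn ha
  have hcard : (S n).ncard = (S b).ncard :=
    Nat.stabilises_of_monotone (f := fun n => (S n).ncard)
      (fun m n hmn => Set.ncard_le_ncard (hS hmn) (hb n x).1) (fun m => (hb m x).2) (fun m hm => by
        -- Further factors from `W` are multiplied on the range side and keep the source `x`. Hence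
        -- each `S (m + 1)` is determined by `S m`, and one repetition makes the sequence constant.
        -- Cardinalities bounded by `b` leave at most `b` strict increases, so the sequence is
        -- constant from `b` on.
        have e : S m = S (m + 1) :=
          Set.eq_of_subset_of_ncard_le (hS m.le_succ) hm.ge (hb _ x).1
        have e' : S (m + 2) ⊆ S (m + 1) := by
          rintro ⟨z, k⟩ hk
          obtain ⟨w, h, g, hh, hg, rfl⟩ := exists_comp_of_mem_setMul (k := k) hk
          have : (⟨w, h⟩ : Σ y : G, x ⟶ y) ∈ S m := e ▸ hh
          exact comp_mem_setMul this hg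
        exact congrArg Set.ncard ((hS (m + 1).le_succ).antisymm e')) h
  have e : S b = S n := Set.eq_of_subset_of_ncard_le (hS h) hcard.le (hb n x).1
  have : (⟨y, g⟩ : Σ y : G, x ⟶ y) ∈ S b := e ▸ hg
  exact this

/-- A power of a symmetric set of arrows that contains all further powers is a subgroupoid. -/
noncomputable def setPowSubgroupoid (hW : ∀ γ ∈ W, γ.inverse ∈ W) {b : ℕ}
    (hb : ∀ n, setPow W n ⊆ setPow W b) : Subgroupoid G where
  arrows c d := {g | (⟨c, d, g⟩ : Arrows G) ∈ setPow W b}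
  inv {c d p} hp := by
    rw [Groupoid.inv_eq_inv]
    exact inv_mem_setPow hW hp
  -- A product of two elements of the power with index b has 2b + 2 factors, hence index 2b + 1.
  mul {c d e p} hp {q} hq := hb (b + b + 1) (by
    rw [← setMul_setPow]
    exact comp_mem_setMul hp hq)

end Arrows

/-! ### Quasi-compact open subgroupoids and the two assertions -/

namespace AmpleGroupoid

variable {G : Type u} [Groupoid.{u} G] [TopologicalSpace G] [TopologicalSpace (Arrows G)]
  [AmpleGroupoid G] {R : Type v} [Ring R]

attribute [local instance] locallyCompactSpace t2Space totallyDisconnectedSpace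

lemma isOpen_setMul {U V : Set (Arrows G)} (hU : IsOpen U) (hV : IsOpen V) :
    IsOpen (Arrows.setMul U V) := by
  rw [isOpen_iff_mem_nhds]
  rintro ⟨x, z, k⟩ hk
  obtain ⟨y, h, g, hh, hg, rfl⟩ := Arrows.exists_comp_of_mem_setMul hk
  obtain ⟨U', hU', hgU', hUU'⟩ := exists_bisection_subset hU hg
  obtain ⟨V', hV', hhV', hVV'⟩ := exists_bisection_subset hV hh
  refine Filter.mem_of_superset ((hU'.setMul hV').isOpen.mem_nhds
    (Arrows.comp_mem_setMul hhV' hgU')) ?_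
  rintro _ ⟨a, h1, h2⟩
  exact ⟨a, hUU' h1, hVV' h2⟩

/-- The composable pairs form a closed set because the unit space is Hausdorff, even if the space of
arrows is not. The product set is the image of a quasi-compact set of composable pairs. -/
lemma isCompact_setMul {U V : Set (Arrows G)} (hU : IsCompact U) (hV : IsCompact V) :
    IsCompact (Arrows.setMul U V) := by
  have hcl : IsClosed {p : Arrows G × Arrows G | p.2.right = p.1.left} :=
    isClosed_eq (continuous_range.comp continuous_snd) (continuous_source.comp continuous_fst)
  have hc := hcl.isClosedEmbedding_subtypeVal.isCompact_preimage (hU.prod hV)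
  convert hc.image (continuous_mul (G := G)) using 1
  ext γ
  rw [Arrows.mem_setMul_iff]
  constructor
  · rintro ⟨g, hg, h, hh, e, rfl⟩
    exact ⟨⟨(g, h), e⟩, ⟨hg, hh⟩, rfl⟩
  · rintro ⟨⟨⟨g, h⟩, e⟩, ⟨hg, hh⟩, rfl⟩
    exact ⟨g, hg, h, hh, e, rfl⟩

lemma isOpen_setPow {W : Set (Arrows G)} (hW : IsOpen W) : ∀ n, IsOpen (Arrows.setPow W n)
  | 0 => hW
  | n + 1 => isOpen_setMul hW (isOpen_setPow hW n)

lemma isCompact_setPow {W : Set (Arrows G)} (hW : IsCompact W) :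
    ∀ n, IsCompact (Arrows.setPow W n)
  | 0 => hW
  | n + 1 => isCompact_setMul hW (isCompact_setPow hW n)

/-- A function in the span is a finite sum of multiples of characteristic functions of bisections,
and each of these meets a range fibre at most once. -/
lemma exists_bound_rangeFiber {f : Arrows G → R} (hf : f ∈ compactOpenSpan R (Arrows G)) :
    ∃ b : ℕ, ∀ y : G, {a : Σ z : G, z ⟶ y | f ⟨a.1, y, a.2⟩ ≠ 0}.ncard ≤ b := by
  induction hf using bisection_induction with
  | zero => exact ⟨0, fun y => by simp⟩
  | add f hf g hg h1 h2 =>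
    obtain ⟨b, hb⟩ := h1
    obtain ⟨c, hc⟩ := h2
    refine ⟨b + c, fun y => ?_⟩
    refine (Set.ncard_le_ncard ?_ (((fiberFinite hf).1 y).union ((fiberFinite hg).1 y))).trans
      ((Set.ncard_union_le _ _).trans (add_le_add (hb y) (hc y)))
    intro a ha
    by_contra h
    simp only [Set.mem_union, Set.mem_ofPred_eq, not_or, not_not] at h
    exact ha (by rw [Pi.add_apply, h.1, h.2, add_zero])
  | ind U hU r =>
    refine ⟨1, fun y => (Set.ncard_le_one ((hU.fiberFinite r).1 y)).2 ?_⟩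
    rintro ⟨z, a⟩ ha ⟨w, b⟩ hb
    have := hU.range_inj (Set.mem_of_indicator_ne_zero ha) (Set.mem_of_indicator_ne_zero hb) rfl
    cases this
    rfl

/-- If the homological dimension is zero, then every quasi-compact open set of arrows is contained
in a quasi-compact open subgroupoid. -/
theorem exists_subgroupoid [Nontrivial R] (hG : homologicalDimension R G = 0) {W₀ : Set (Arrows G)}
    (hW₀ : IsOpen W₀) (hW₀' : IsCompact W₀) :
    ∃ H : Subgroupoid G, W₀ ⊆ H.arrowSet ∧ IsOpen H.arrowSet ∧ IsCompact H.arrowSet := by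
  let L : Set G := (fun g : Arrows G => g.left) '' W₀ ∪ (fun g : Arrows G => g.right) '' W₀
  have hL : IsOpen L := (isLocalHomeomorph_source.isOpenMap W₀ hW₀).union
    (isLocalHomeomorph_range.isOpenMap W₀ hW₀)
  have hL' : IsCompact L := (hW₀'.image continuous_source).union (hW₀'.image continuous_range)
  have hE := isCompactBisection_unit hL hL'
  -- Inverses make the powers symmetric, and units make them increasing.
  let W : Set (Arrows G) := (W₀ ∪ Arrows.inverse '' W₀) ∪ Arrows.unit '' L
  have hW : IsOpen W := (hW₀.union (inverseHomeomorph.isOpenMap _ hW₀)).union hE.isOpen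
  have hW' : IsCompact W := (hW₀'.union (hW₀'.image continuous_inverse)).union hE.isCompact
  have hWL : ∀ γ ∈ W, γ.left ∈ L ∧ γ.right ∈ L := by
    rintro γ ((h | ⟨γ, h, rfl⟩) | ⟨x, hx, rfl⟩)
    · exact ⟨Or.inl ⟨γ, h, rfl⟩, Or.inr ⟨γ, h, rfl⟩⟩
    · exact ⟨Or.inr ⟨γ, h, rfl⟩, Or.inl ⟨γ, h, rfl⟩⟩
    · exact ⟨hx, hx⟩
  have hWunit : ∀ γ ∈ W, Arrows.unit γ.right ∈ W := fun γ hγ => Or.inr ⟨_, (hWL γ hγ).2, rfl⟩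
  have hWinv : ∀ γ ∈ W, γ.inverse ∈ W := by
    rintro γ ((h | ⟨γ, h, rfl⟩) | ⟨x, hx, rfl⟩)
    · exact Or.inl (Or.inr ⟨γ, h, rfl⟩)
    · rw [Arrows.inverse_inverse]
      exact Or.inl (Or.inl h)
    · exact Or.inr ⟨x, hx, by simp [Arrows.inverse, Arrows.unit]⟩
  obtain ⟨K, hLK, u, hu, hu1, hinv⟩ := exists_invariant hG hW hW' hL hL'
  have hinv' : ∀ n {x y z : G} (g : x ⟶ y) (h : y ⟶ z),
      (⟨x, y, g⟩ : Arrows G) ∈ Arrows.setPow W n → u ⟨x, z, g ≫ h⟩ = u ⟨y, z, h⟩ := by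
    intro n
    induction n with
    | zero => exact fun g h hg => hinv g h hg
    | succ n ih =>
      intro x y z g h hg
      obtain ⟨w, k, l, hk, hl, rfl⟩ := Arrows.exists_comp_of_mem_setMul hg
      rw [Category.assoc, ih k _ hk, hinv l h hl]
  obtain ⟨b, hb⟩ := exists_bound_rangeFiber hu
  have hbound : ∀ n (x : G),
      {a : Σ y : G, x ⟶ y | (⟨x, a.1, a.2⟩ : Arrows G) ∈ Arrows.setPow W n}.Finite ∧
      {a : Σ y : G, x ⟶ y | (⟨x, a.1, a.2⟩ : Arrows G) ∈ Arrows.setPow W n}.ncard ≤ b := by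
    intro n x
    obtain h | ⟨⟨y, g⟩, hg⟩ := Set.eq_empty_or_nonempty
      {a : Σ y : G, x ⟶ y | (⟨x, a.1, a.2⟩ : Arrows G) ∈ Arrows.setPow W n}
    · rw [h]
      exact ⟨Set.finite_empty, by simp⟩
    have hx : x ∈ K := hLK (hWL _ (Arrows.unit_mem_of_mem_setPow hWunit
      (Arrows.inv_mem_setPow hWinv hg))).1
    -- The values of `u` at arrows with source `x` sum to 1, which is nonzero in `R`.
    obtain ⟨⟨z, k⟩, hk⟩ : ∃ k : Σ y : G, x ⟶ y, u ⟨x, k.1, k.2⟩ ≠ 0 := by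
      by_contra! h0
      have h1 := congrFun hu1 x
      rw [Set.indicator_of_mem hx, augmentation, unitAction, finsum_eq_zero_of_forall_eq_zero
        fun k => by rw [h0 k, mul_zero]] at h1
      exact zero_ne_one h1
    -- For `h` in a power of `W`, invariance gives `u (inv h ≫ k) = u k ≠ 0`. So `f` maps into the
    -- support of `u` in the range fibre of `z`, which has at most `b` elements whatever `x` and `n`
    -- are.
    let f : (Σ y : G, x ⟶ y) → Σ w : G, w ⟶ z := fun a => ⟨a.1, inv a.2 ≫ k⟩
    have hf : Set.MapsTo f {a | (⟨x, a.1, a.2⟩ : Arrows G) ∈ Arrows.setPow W n}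
        {a | u ⟨a.1, z, a.2⟩ ≠ 0} := by
      rintro ⟨w, h⟩ hh
      have h1 := hinv' n h (inv h ≫ k) hh
      rw [IsIso.hom_inv_id_assoc] at h1
      change u ⟨w, z, inv h ≫ k⟩ ≠ 0
      rwa [← h1]
    have hf' : Function.Injective f := by
      rintro ⟨w, h⟩ ⟨w', h'⟩ e
      obtain rfl : w = w' := congrArg Sigma.fst e
      have e1 : inv h ≫ k = inv h' ≫ k := eq_of_heq (Sigma.mk.inj e).2
      rw [cancel_mono, IsIso.inv_eq_inv] at e1
      rw [e1]
    have hfin := (fiberFinite hu).1 z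
    exact ⟨hfin.of_injOn hf hf'.injOn,
      (Set.ncard_le_ncard_of_injOn f hf hf'.injOn hfin).trans (hb z)⟩
  have hstab := Arrows.setPow_subset_of_ncard_le hWunit hbound
  refine ⟨Arrows.setPowSubgroupoid hWinv hstab, ?_, isOpen_setPow hW b, isCompact_setPow hW' b⟩
  exact fun γ hγ => hstab 0 (Or.inl (Or.inl hγ))

/-- All quasi-compact open subgroupoids are taken. An upper bound of two of them comes from
`exists_subgroupoid` for the union of their arrow sets, and every arrow lies in a compact bisection.
-/
lemma isDirectedUnion [Nontrivial R] (hG : homologicalDimension R G = 0) :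
    IsDirectedUnionOfQuasiCompactOpen G := by
  refine ⟨{H | IsOpen H.arrowSet ∧ IsCompact H.arrowSet}, ?_, ?_, fun H hH => hH, ?_⟩
  · obtain ⟨H, -, hH⟩ := exists_subgroupoid hG isOpen_empty isCompact_empty
    exact ⟨H, hH⟩
  · intro H hH H' hH'
    obtain ⟨H'', h, h''⟩ := exists_subgroupoid hG (hH.1.union hH'.1) (hH.2.union hH'.2)
    exact ⟨H'', h'',
      (Subgroupoid.le_iff _ _).2 fun {c d} g hg =>
        h (Or.inl (show (⟨c, d, g⟩ : Arrows G) ∈ H.arrowSet from hg)),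
      (Subgroupoid.le_iff _ _).2 fun {c d} g hg =>
        h (Or.inr (show (⟨c, d, g⟩ : Arrows G) ∈ H'.arrowSet from hg))⟩
  · refine Set.eq_univ_of_forall fun γ => ?_
    obtain ⟨U, hU, hγ, -⟩ := exists_bisection_subset isOpen_univ (Set.mem_univ γ)
    obtain ⟨H, h, hH⟩ := exists_subgroupoid hG hU.isOpen hU.isCompact
    exact Set.mem_biUnion hH (h hγ)

/-- Finitely many compact bisections cover `K`. A function invariant under their union restricts, on
the arrows with source `x`, to a `K`-invariant function with sum one. -/
lemma isUnit_card (hG : homologicalDimension R G = 0) (x : G) (K : Subgroup (x ⟶ x)) [Finite K] :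
    IsUnit (Nat.card K : R) := by
  choose U hU hgU _ using fun g : K =>
    exists_bisection_subset isOpen_univ (Set.mem_univ (⟨x, x, g.1⟩ : Arrows G))
  obtain ⟨L, hL, hL', hxL, -⟩ := exists_compactOpen_subset isOpen_univ (Set.mem_univ x)
  obtain ⟨M, hLM, u, hu, hu1, hinv⟩ := exists_invariant hG
    (isOpen_iUnion fun g => (hU g).isOpen) (isCompact_iUnion fun g => (hU g).isCompact) hL hL'
  refine isUnit_card_of_invariant K (fun k => u ⟨x, k.1, k.2⟩) ((fiberFinite hu).2 x)
    (fun g hg y h => hinv g h (Set.mem_iUnion.2 ⟨⟨g, hg⟩, hgU _⟩)) ?_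
  have h1 := congrFun hu1 x
  rw [Set.indicator_of_mem (hLM hxL), augmentation, unitAction] at h1
  simpa only [one_mul] using h1

end AmpleGroupoid

theorem theoremt (R : Type v) [Ring R] [Nontrivial R] (G : Type u) [Groupoid.{u} G]
    [TopologicalSpace G] [TopologicalSpace (Arrows G)] [AmpleGroupoid G]
    (hG : homologicalDimension R G = 0) :
    IsDirectedUnionOfQuasiCompactOpen G ∧
      ∀ (x : G) (K : Subgroup (x ⟶ x)), Finite K → IsUnit (Nat.card K : R) :=
  ⟨AmpleGroupoid.isDirectedUnion hG, fun x K _ => AmpleGroupoid.isUnit_card hG x K⟩
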